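/- All graphs are finite, undirected and simple. A connected graph is $t$-connected if it has more than $t$ vertices and remains connected whenever fewer than $t$ vertices are removed. A leaf of a tree is a vertex of degree one. For a graph $G$ and an integer $l \ge 0$, the $l$-closure $C_l(G)$ is the graph obtained from $G$ by recursively joining pairs of distinct non-adjacent vertices whose degree sum (in the current graph) is at least $l$, until no such pair remains; it does not depend on the choices made. $G_1 \nabla G_2$ denotes the join of $G_1$ and $G_2$ (their disjoint union plus all edges between them), $\cup$ is disjoint union, $K_m$ is the complete graph on $m$ vertices and $mK_1$ is the graph with $m$ vertices and no edges. Theorem 1.6. Let $k \ge 2$ and $t \ge 1$ be integers, and let $G$ be a $t$-connected graph of order $n$ with $n \ge \max\{6k+6t-1,\ k^2+tk+t+1\}$ and number of edges $$e(G) \ge \binom{n-k-t}{2} + (k+t-1)^2 + k + t.$$ Then $G$ has a spanning tree with at most $k$ leaves unless $C_{n-1}(G) \cong K_t \nabla (K_{n-k-2t+1} \cup (k+t-1)K_1)$, and in this exceptional case $G$ has no such spanning tree. -/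

import Mathlib

namespace SpanningEnded

open Classical in
/-- One step of the `l`-closure process: `H` arises from `G` by joining one pair of distinct
non-adjacent vertices whose degree sum in `G` is at least `l`. -/
def ClosureStep {V : Type*} [Fintype V] (l : ℕ) (G H : SimpleGraph V) : Prop :=
  ∃ u v : V, u ≠ v ∧ ¬ G.Adj u v ∧ l ≤ G.degree u + G.degree v ∧ H = G ⊔ SimpleGraph.edge u v

open Classical in
/-- `G` is `l`-closed: no two distinct non-adjacent vertices have degree sum at least `l`. -/
def IsDegClosed {V : Type*} [Fintype V] (l : ℕ) (G : SimpleGraph V) : Prop :=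
  ∀ u v : V, u ≠ v → ¬ G.Adj u v → G.degree u + G.degree v < l

/-- `H` is a possible final outcome of the `l`-closure process started at `G`. -/
def IsClosureOf {V : Type*} [Fintype V] (l : ℕ) (G H : SimpleGraph V) : Prop :=
  Relation.ReflTransGen (ClosureStep l) G H ∧ IsDegClosed l H

theorem ClosureStep.lt {V : Type*} [Fintype V] {l : ℕ} {G H : SimpleGraph V}
    (h : ClosureStep l G H) : G < H := by
  obtain ⟨u, v, huv, hn, -, rfl⟩ := h
  refine lt_of_le_of_ne le_sup_left fun he => hn ?_
  rw [he]
  exact Or.inr ((SimpleGraph.edge_adj u v u v).2 ⟨Or.inl ⟨rfl, rfl⟩, huv⟩)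

/-- The closure process terminates. -/
theorem exists_isClosureOf {V : Type*} [Fintype V] (l : ℕ) (G : SimpleGraph V) :
    ∃ H, IsClosureOf l G H := by
  induction G using WellFoundedGT.induction with
  | ind G ih =>
    by_cases hc : IsDegClosed l G
    · exact ⟨G, Relation.ReflTransGen.refl, hc⟩
    · unfold IsDegClosed at hc
      push Not at hc
      obtain ⟨u, v, huv, hn, hl⟩ := hc
      have hs : ClosureStep l G (G ⊔ SimpleGraph.edge u v) := ⟨u, v, huv, hn, hl, rfl⟩
      obtain ⟨H, h1, h2⟩ := ih _ hs.lt
      exact ⟨H, Relation.ReflTransGen.head hs h1, h2⟩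

theorem le_of_reflTransGen_of_isDegClosed {V : Type*} [Fintype V] {l : ℕ}
    {G H K : SimpleGraph V} (h : Relation.ReflTransGen (ClosureStep l) G H) (hGK : G ≤ K)
    (hK : IsDegClosed l K) : H ≤ K := by
  induction h with
  | refl => exact hGK
  | tail _ hs ih =>
    obtain ⟨u, v, huv, -, hl, rfl⟩ := hs
    refine sup_le ih ?_
    have hadj : K.Adj u v := by
      classical
      by_contra hn
      have h1 := hK u v huv hn
      have h2 := SimpleGraph.degree_le_of_le (v := u) ih
      have h3 := SimpleGraph.degree_le_of_le (v := v) ih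
      refine absurd hl (not_le.2 (lt_of_le_of_lt (add_le_add ?_ ?_) h1))
      · convert h2
      · convert h3
    intro a b hab
    rw [SimpleGraph.edge_adj] at hab
    rcases hab.1 with ⟨rfl, rfl⟩ | ⟨rfl, rfl⟩
    · exact hadj
    · exact hadj.symm

theorem IsClosureOf.le {V : Type*} [Fintype V] {l : ℕ} {G H : SimpleGraph V}
    (h : IsClosureOf l G H) : G ≤ H := by
  have h1 := h.1
  induction h1 using Relation.ReflTransGen.head_induction_on with
  | refl => exact le_rfl
  | head hs h2 ih => exact hs.lt.le.trans (ih ⟨h2, h.2⟩)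

/-- The outcome of the closure process does not depend on the choices made. -/
theorem IsClosureOf.unique {V : Type*} [Fintype V] {l : ℕ} {G H K : SimpleGraph V}
    (hH : IsClosureOf l G H) (hK : IsClosureOf l G K) : H = K :=
  le_antisymm (le_of_reflTransGen_of_isDegClosed hH.1 hK.le hK.2)
    (le_of_reflTransGen_of_isDegClosed hK.1 hH.le hH.2)

/-- The `l`-closure of a finite graph `G`: the unique outcome of recursively joining pairs of
non-adjacent vertices with degree sum at least `l` until no such pair remains. -/
noncomputable def degClosure {V : Type*} [Fintype V] (l : ℕ) (G : SimpleGraph V) :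
    SimpleGraph V :=
  Classical.choose (exists_isClosureOf l G)

theorem degClosure_spec {V : Type*} [Fintype V] (l : ℕ) (G : SimpleGraph V) :
    IsClosureOf l G (degClosure l G) :=
  Classical.choose_spec (exists_isClosureOf l G)

/-- `G` is `t`-connected: it is connected, has more than `t` vertices, and remains connected
whenever fewer than `t` vertices are removed. -/
def IsTConnected {V : Type*} [Fintype V] (t : ℕ) (G : SimpleGraph V) : Prop :=
  G.Connected ∧ t < Fintype.card V ∧
    ∀ S : Finset V, S.card < t → (G.induce {v | v ∉ S}).Connected

open Classical in
/-- `G` has a spanning tree with at most `k` leaves (vertices of degree one in the tree). -/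
def HasSpanningEndedTree {V : Type*} [Fintype V] (k : ℕ) (G : SimpleGraph V) : Prop :=
  ∃ T : SimpleGraph V, T ≤ G ∧ T.IsTree ∧ (Finset.univ.filter fun v => T.degree v = 1).card ≤ k

/-- The join of two graphs: their disjoint union together with all edges between them. -/
def join {V W : Type*} (G : SimpleGraph V) (H : SimpleGraph W) : SimpleGraph (V ⊕ W) :=
  SimpleGraph.sum G H ⊔ completeBipartiteGraph V W

/-- The graph `K_a ∇ (K_b ∪ c K_1)`. -/
def joinGraph (a b c : ℕ) : SimpleGraph (Fin a ⊕ (Fin b ⊕ Fin c)) :=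
  join (⊤ : SimpleGraph (Fin a))
    (SimpleGraph.sum (⊤ : SimpleGraph (Fin b)) (⊥ : SimpleGraph (Fin c)))

end SpanningEnded

/-!
A graph with many edges has an `(n - 1)`-closure `H` that is a clique up to a few vertices, and for
such a graph the existence of a spanning tree with at most `k` leaves is decided by looking at a
longest path through the clique.

* Passing to the closure (`hasSpanningEndedTree_of_sup_edge`). Let `T` be a spanning tree of
  `G + uv` with at most `k` leaves that uses `uv`. If `s` lies on the side of `u` in `T - uv` and is
  adjacent to `v` in `G`, then either `s` is a leaf and `uv` can be replaced by `vs`, or `s` has a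
  child `x` in the tree rooted at `u`. If moreover `x` is adjacent to `u` in `G`, then replacing
  `uv`, `sx` by `vs`, `ux` preserves all degrees. If no replacement is possible, the neighbours of
  `v` on this side have distinct children that are not neighbours of `u`; adding the same estimate
  for the other side gives `d(u) + d(v) ≤ n - 2`.
* The clique (`exists_clique_of_isDegClosed`). In `H` the vertices of degree at least `(n - 1) / 2`
  form a clique. A maximal clique `C` containing them bounds the degrees outside `C`, and the edge
  count forces `|V \ C| ≤ k + t - 1`.
* The structure (`exists_common_neighborhood`). Let `P` be a longest path containing `C`. By the
  Chvátal–Erdős argument (`IsMaxPath.chvatal_erdos`), `t`-connectedness gives at least `t` vertices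
  of `P` outside `C`. Attaching the remaining vertices one by one to `P` gives a spanning tree with
  at most `k` leaves unless `|V \ C| = k + t - 1`, exactly `t` vertices of `P` are outside `C`, and
  the vertices off `P` are independent. In this case the neighbours of each vertex off `P` are the
  path neighbours of the vertices of `P` outside `C`; exchanging a vertex of `P` with one off `P`
  shows that all vertices outside `C` have the same `t` neighbours, so that `H` is the exceptional
  graph.
* The exceptional graph has no such tree (`card_add_two_le_leafCount`): the `t` dominating vertices
  must cover too many tree edges, which forces at least `k + 1` leaves.
-/

namespace SpanningEnded

open SimpleGraph

open scoped Classical in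
/-- The number of leaves (vertices of degree one) of a finite graph. -/
noncomputable def leafCount {V : Type*} [Fintype V] (T : SimpleGraph V) : ℕ :=
  (Finset.univ.filter fun v => T.degree v = 1).card

theorem hasSpanningEndedTree_iff {V : Type*} [Fintype V] {k : ℕ} {G : SimpleGraph V} :
    HasSpanningEndedTree k G ↔ ∃ T ≤ G, T.IsTree ∧ leafCount T ≤ k := by
  unfold HasSpanningEndedTree leafCount
  rfl

/-! ### Edge exchanges in trees -/

section Exchange

variable {V : Type*}

open scoped Classical in
/-- A connected graph with at most `|V| - 1` edges is a tree. -/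
theorem isTree_of_connected_of_card_le [Fintype V] {T : SimpleGraph V} (hc : T.Connected)
    (he : T.edgeFinset.card + 1 ≤ Fintype.card V) : T.IsTree := by
  rw [isTree_iff_connected_and_card]
  refine ⟨hc, le_antisymm ?_ hc.card_vert_le_card_edgeSet_add_one⟩
  rwa [Nat.card_eq_fintype_card, Nat.card_eq_fintype_card, ← edgeFinset_card]

/-- If every edge of a connected graph `T` joins two vertices in the same component of `T'`, then
`T'` is connected. -/
theorem connected_of_forall_adj_reachable {T T' : SimpleGraph V} (hc : T.Connected)
    (h : ∀ a b, T.Adj a b → T'.Reachable a b) : T'.Connected := by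
  have hne := hc.nonempty
  refine (connected_iff _).2 ⟨fun a b => ?_, hne⟩
  obtain ⟨p⟩ := hc.preconnected a b
  induction p with
  | nil => rfl
  | cons hab _ ih => exact (h _ _ hab).trans ih

open scoped Classical in
/-- Replacing an edge `ab` of a tree by an edge `cd` gives a tree as soon as `a` and `b` are still
connected. -/
theorem isTree_exchange [Finite V] {T : SimpleGraph V} (hT : T.IsTree) {a b c d : V} (hab : T.Adj a b)
    (hr : (T.deleteEdges {s(a, b)} ⊔ edge c d).Reachable a b) :
    (T.deleteEdges {s(a, b)} ⊔ edge c d).IsTree := by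
  have := Fintype.ofFinite V
  apply isTree_of_connected_of_card_le
  · refine connected_of_forall_adj_reachable hT.connected fun x y hxy => ?_
    by_cases h : s(x, y) = s(a, b)
    · rcases Sym2.eq_iff.1 h with ⟨rfl, rfl⟩ | ⟨rfl, rfl⟩
      · exact hr
      · exact hr.symm
    · apply Adj.reachable
      left
      rw [deleteEdges_adj]
      exact ⟨hxy, h⟩
  · have h1 := hT.card_edgeFinset
    refine le_trans (Nat.succ_le_succ (Finset.card_le_card
      (t := insert s(c, d) (T.edgeFinset.erase s(a, b))) ?_)) ?_
    rotate_left
    · have h4 := Finset.card_insert_le s(c, d) (T.edgeFinset.erase s(a, b))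
      have h5 : s(a, b) ∈ T.edgeFinset := by simpa using hab
      have h6 := Finset.card_erase_add_one h5
      omega
    · intro e
      induction e with | h x y =>
      simp only [mem_edgeFinset, mem_edgeSet, sup_adj, deleteEdges_adj, edge_adj,
        Finset.mem_insert, Finset.mem_erase, Set.mem_singleton_iff]
      rintro (⟨h1, h2⟩ | ⟨h1, -⟩)
      · exact Or.inr ⟨h2, h1⟩
      · left
        rcases h1 with ⟨rfl, rfl⟩ | ⟨rfl, rfl⟩
        · rfl
        · exact Sym2.eq_swap

/-- A walk of `T` that avoids a vertex `z` survives in every graph containing all edges of `T` not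
incident to `z`. -/
theorem reachable_of_walk_of_notMem {T T' : SimpleGraph V} {Z : Set V}
    (h : ∀ a b, T.Adj a b → (a ∉ Z ∧ b ∉ Z) → T'.Adj a b) {u s : V} (p : T.Walk u s)
    (hp : ∀ z ∈ p.support, z ∉ Z) : T'.Reachable u s := by
  induction p with
  | nil => rfl
  | cons hab q ih =>
    have h1 := hp _ (Walk.start_mem_support _)
    have h2 : ∀ z ∈ q.support, z ∉ Z := fun z hz => hp z (by simp [hz])
    exact (h _ _ hab ⟨h1, h2 _ (by simp)⟩).reachable.trans (ih h2)

open scoped Classical in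
theorem degree_eq_of_exchange [Fintype V] {T T' : SimpleGraph V} {a v x : V} (hav : T.Adj a v)
    (hax : ¬ T.Adj a x) (h : ∀ b, T'.Adj a b ↔ (T.Adj a b ∧ b ≠ v) ∨ b = x) :
    T'.degree a = T.degree a := by
  rw [← card_neighborFinset_eq_degree, ← card_neighborFinset_eq_degree]
  have h1 : T'.neighborFinset a = insert x ((T.neighborFinset a).erase v) := by
    ext b
    simp only [mem_neighborFinset, h, Finset.mem_insert, Finset.mem_erase]
    tauto
  rw [h1, Finset.card_insert_of_notMem (by simp [hax]), Finset.card_erase_add_one (by simpa)]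

open scoped Classical in
theorem degree_eq_of_adj_iff [Fintype V] {T T' : SimpleGraph V} {a : V}
    (h : ∀ b, T'.Adj a b ↔ T.Adj a b) : T'.degree a = T.degree a := by
  rw [← card_neighborFinset_eq_degree, ← card_neighborFinset_eq_degree]
  congr 1
  ext b
  simp [h]

end Exchange

/-! ### The closure lemma -/

section Closure

variable {V : Type*}

/-- The unique path between two vertices of a tree. -/
noncomputable def treePath {T : SimpleGraph V} (hT : T.IsTree) (u x : V) : T.Walk u x :=
  (hT.existsUnique_path u x).choose

theorem treePath_isPath {T : SimpleGraph V} (hT : T.IsTree) (u x : V) :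
    (treePath hT u x).IsPath := (hT.existsUnique_path u x).choose_spec.1

theorem treePath_eq {T : SimpleGraph V} (hT : T.IsTree) {u x : V} {p : T.Walk u x}
    (hp : p.IsPath) : p = treePath hT u x := (hT.existsUnique_path u x).choose_spec.2 p hp

/-- In the tree `T` rooted at `u`, the vertex `x` is a child of `s`. -/
def IsChild {T : SimpleGraph V} (hT : T.IsTree) (u s x : V) : Prop :=
  T.Adj s x ∧ x ∉ (treePath hT u s).support

theorem IsChild.treePath_eq {T : SimpleGraph V} {hT : T.IsTree} {u s x : V}
    (h : IsChild hT u s x) : treePath hT u x = (treePath hT u s).concat h.1 :=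
  (SpanningEnded.treePath_eq hT ((treePath_isPath hT u s).concat h.2 h.1)).symm

theorem IsChild.parent_unique {T : SimpleGraph V} {hT : T.IsTree} {u s s' x : V}
    (h : IsChild hT u s x) (h' : IsChild hT u s' x) : s = s' := by
  have h1 := congrArg Walk.penultimate (h.treePath_eq.symm.trans h'.treePath_eq)
  simpa using h1

open scoped Classical in
/-- A vertex other than the root is a leaf or has a child. -/
theorem exists_isChild [Fintype V] {T : SimpleGraph V} (hT : T.IsTree) {u s : V} (hs : s ≠ u)
    (hd : T.degree s ≠ 1) : ∃ x, IsChild hT u s x := by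
  have hp := treePath_isPath hT u s
  have hnn : ¬ (treePath hT u s).Nil := Walk.not_nil_of_ne hs.symm
  have hadj := ((treePath hT u s).adj_penultimate hnn).symm
  have h1 : 0 < T.degree s := by
    rw [degree_pos_iff_exists_adj]
    exact ⟨_, hadj⟩
  obtain ⟨x, hx, hne⟩ := Finset.exists_mem_ne (s := T.neighborFinset s)
    (by rw [card_neighborFinset_eq_degree]; omega) (treePath hT u s).penultimate
  rw [mem_neighborFinset] at hx
  refine ⟨x, hx, fun hmem => hne ?_⟩
  exact hT.isAcyclic.eq_penultimate_of_adj_end hp hx hmem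

theorem mem_treePath_iff {T : SimpleGraph V} (hT : T.IsTree) {u v : V} (huv : T.Adj u v) (x : V) :
    v ∈ (treePath hT u x).support ↔ u ∉ (treePath hT v x).support := by
  have aux : ∀ {u v : V}, T.Adj u v → u ∉ (treePath hT v x).support →
      v ∈ (treePath hT u x).support := by
    intro u v huv h
    have h1 : (Walk.cons huv (treePath hT v x)).IsPath := (treePath_isPath hT v x).cons h
    rw [← treePath_eq hT h1]
    simp
  refine ⟨fun h hu => ?_, aux huv⟩
  have hp := treePath_isPath hT u x
  have hv := hT.isAcyclic.eq_snd_of_adj_start hp huv h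
  have hnn : ¬ (treePath hT u x).Nil := by
    intro hn
    have : u = x := hn.eq
    subst this
    rw [← treePath_eq hT (Walk.IsPath.nil (u := u))] at h
    simp at h
    exact huv.ne h.symm
  have key : ∀ q : T.Walk u x, q.IsPath → v ∈ q.support → v = q.snd →
      u ∉ (treePath hT v x).support := by
    intro q hq hvq hs
    cases q with
    | nil => simp at hvq; exact absurd hvq.symm huv.ne
    | cons hab r =>
      simp only [Walk.snd_cons] at hs
      subst hs
      rw [Walk.cons_isPath_iff] at hq
      rw [← treePath_eq hT hq.1]
      exact hq.2
  exact key _ hp h hv hu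

variable [Fintype V]

open scoped Classical in
/-- The leaf exchange: `uv` is replaced by an edge `vs`, where `s` is a leaf on the side of `u`. -/
theorem leaf_exchange {G T : SimpleGraph V} (hT : T.IsTree) {u v s : V} {k : ℕ}
    (hG : T ≤ G ⊔ edge u v) (hk : leafCount T ≤ k) (huv : T.Adj u v)
    (hsu : s ≠ u) (hs : v ∉ (treePath hT u s).support) (hvs : G.Adj v s) (hd : T.degree s = 1) :
    HasSpanningEndedTree k G := by
  rw [hasSpanningEndedTree_iff]
  have hsv : s ≠ v := hvs.ne'
  obtain ⟨T1, hT1⟩ : ∃ T1, T1 = T.deleteEdges {s(u, v)} ⊔ edge v s := ⟨_, rfl⟩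
  refine ⟨T1, ?_, ?_, ?_⟩
  · intro a b hab
    rw [hT1] at hab
    rcases hab with hab | hab
    · rw [deleteEdges_adj] at hab
      rcases hG hab.1 with h | h
      · exact h
      · rw [edge_adj] at h
        rcases h.1 with ⟨rfl, rfl⟩ | ⟨rfl, rfl⟩ <;> simp at hab
    · rw [edge_adj] at hab
      rcases hab.1 with ⟨rfl, rfl⟩ | ⟨rfl, rfl⟩
      exacts [hvs, hvs.symm]
  · rw [hT1]
    refine isTree_exchange hT huv ?_
    have h1 : (T.deleteEdges {s(u, v)} ⊔ edge v s).Reachable u s := by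
      refine reachable_of_walk_of_notMem (Z := {v}) (fun a b hab hZ => ?_) (treePath hT u s)
        (fun z hz h => hs (h ▸ hz))
      left
      rw [deleteEdges_adj]
      refine ⟨hab, fun h => ?_⟩
      simp only [Set.mem_singleton_iff, Sym2.eq_iff] at h hZ
      tauto
    refine h1.trans (Adj.reachable ?_)
    right
    rw [edge_adj]
    exact ⟨Or.inr ⟨rfl, rfl⟩, hsv⟩
  · refine le_trans ?_ hk
    have hnvs : ¬ T.Adj v s := by
      intro h
      obtain ⟨w, hw⟩ := (degree_eq_one_iff_existsUnique_adj).1 hd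
      have hnn : ¬ (treePath hT u s).Nil := Walk.not_nil_of_ne hsu.symm
      have hadj := ((treePath hT u s).adj_penultimate hnn).symm
      have e1 := hw.2 _ hadj
      have e2 := hw.2 _ h.symm
      apply hs
      rw [e2, ← e1]
      exact Walk.getVert_mem_support _ _
    have hadj : ∀ a b, T1.Adj a b ↔
        (T.Adj a b ∧ ¬ ((a = u ∧ b = v) ∨ (a = v ∧ b = u))) ∨
          ((a = v ∧ b = s) ∨ (a = s ∧ b = v)) := by
      intro a b
      simp only [hT1, sup_adj, deleteEdges_adj, edge_adj, Set.mem_singleton_iff, Sym2.eq_iff]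
      have : v ≠ s := hsv.symm
      constructor
      · tauto
      · rintro (h | ⟨rfl, rfl⟩ | ⟨rfl, rfl⟩) <;> tauto
    have hdv : T1.degree v = T.degree v := by
      refine degree_eq_of_exchange huv.symm hnvs fun b => ?_
      rw [hadj]
      have := huv.ne
      have := hvs.ne
      grind
    have hdo : ∀ a, a ≠ u → a ≠ v → a ≠ s →
        T1.degree a = T.degree a := by
      intro a h1 h2 h3
      refine degree_eq_of_adj_iff fun b => ?_
      rw [hadj]
      grind
    have hds : T1.degree s ≠ 1 := by
      intro h
      obtain ⟨w, hw⟩ := (degree_eq_one_iff_existsUnique_adj).1 h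
      obtain ⟨y, hy⟩ := (degree_eq_one_iff_existsUnique_adj).1 hd
      have e1 := hw.2 y ((hadj _ _).2 (Or.inl ⟨hy.1, by tauto⟩))
      have e2 := hw.2 v ((hadj _ _).2 (Or.inr (Or.inr ⟨rfl, rfl⟩)))
      have : y = v := e1.trans e2.symm
      subst this
      exact hnvs hy.1.symm
    have hsub : (Finset.univ.filter
        fun a => T1.degree a = 1) ⊆
        insert u ((Finset.univ.filter fun a => T.degree a = 1).erase s) := by
      intro a ha
      simp only [Finset.mem_filter, Finset.mem_univ, true_and, Finset.mem_insert,
        Finset.mem_erase] at ha ⊢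
      by_cases h1 : a = u
      · exact Or.inl h1
      right
      have h3 : a ≠ s := by
        rintro rfl
        exact hds ha
      refine ⟨h3, ?_⟩
      by_cases h2 : a = v
      · subst h2
        rwa [hdv] at ha
      · rwa [hdo a h1 h2 h3] at ha
    unfold leafCount
    have h3 := Finset.card_le_card hsub
    have h4 := Finset.card_insert_le u ((Finset.univ.filter fun a => T.degree a = 1).erase s)
    have h6 := Finset.card_erase_add_one
      (show s ∈ Finset.univ.filter fun a => T.degree a = 1 by simpa using hd)
    omega

open scoped Classical in
/-- Replacing the edges `uv` and `sx` by the edges `vs` and `ux` preserves all degrees. -/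
theorem degree_eq_of_double_exchange {T T' : SimpleGraph V} {u v s x : V} (huv : T.Adj u v)
    (hsx : T.Adj s x) (hvs : ¬ T.Adj v s) (hux : ¬ T.Adj u x) (hus : u ≠ s) (hvx : v ≠ x)
    (hvs' : v ≠ s) (hux' : u ≠ x)
    (h : ∀ a b, T'.Adj a b ↔ (T.Adj a b ∧ s(a, b) ≠ s(u, v) ∧ s(a, b) ≠ s(s, x)) ∨
      s(a, b) = s(v, s) ∨ s(a, b) = s(u, x)) (a : V) :
    T'.degree a = T.degree a := by
  have huv' := huv.ne
  have hsx' := hsx.ne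
  simp only [ne_eq, Sym2.eq_iff] at h
  by_cases h1 : a = u
  · subst h1
    refine degree_eq_of_exchange huv hux fun b => ?_
    simp only [h, huv', hux', hus, true_and, false_and, or_false, false_or, not_false_eq_true,
      and_true, ne_eq]
  by_cases h2 : a = v
  · subst h2
    refine degree_eq_of_exchange huv.symm hvs fun b => ?_
    simp only [h, huv'.symm, hvx, hvs', true_and, false_and, or_false, false_or, not_false_eq_true,
      and_true]
  by_cases h3 : a = s
  · subst h3
    refine degree_eq_of_exchange hsx (fun h => hvs h.symm) fun b => ?_
    simp only [h, hsx', hus.symm, hvs'.symm, true_and, false_and, or_false, false_or,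
      not_false_eq_true]
  by_cases h4 : a = x
  · subst h4
    refine degree_eq_of_exchange hsx.symm (fun h => hux h.symm) fun b => ?_
    simp only [h, hsx'.symm, hvx.symm, hux'.symm, true_and, false_and, or_false, false_or,
      not_false_eq_true]
  refine degree_eq_of_adj_iff fun b => ?_
  simp only [h, h1, h2, h3, h4, false_and, or_false, not_false_eq_true, and_true]

set_option maxHeartbeats 800000 in
open scoped Classical in
/-- The degree-preserving exchange: `uv` and `sx` are replaced by `vs` and `ux`, where `x` is a
child of a vertex `s` on the side of `u`. -/
theorem double_exchange {G T : SimpleGraph V} (hT : T.IsTree) {u v s x : V} {k : ℕ}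
    (hG : T ≤ G ⊔ edge u v) (hk : leafCount T ≤ k) (huv : T.Adj u v) (hnuv : ¬ G.Adj u v)
    (hs : v ∉ (treePath hT u s).support) (hvs : G.Adj v s) (hx : IsChild hT u s x)
    (hux : G.Adj u x) : HasSpanningEndedTree k G := by
  rw [hasSpanningEndedTree_iff]
  have hsv : s ≠ v := hvs.ne'
  have hsu : s ≠ u := by
    rintro rfl
    exact hnuv hvs.symm
  have hxv : x ≠ v := by
    rintro rfl
    exact hnuv hux
  have hxu : x ≠ u := hux.ne'
  have hsx : s ≠ x := hx.1.ne
  have hxs := hx.2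
  have hnvs : ¬ T.Adj v s := by
    intro h
    have h1 : IsChild hT u s v := ⟨h.symm, hs⟩
    have h2 : IsChild hT u u v := by
      refine ⟨huv, ?_⟩
      rw [← treePath_eq hT (Walk.IsPath.nil (u := u))]
      simpa using huv.ne'
    exact hsu (h1.parent_unique h2)
  have hnux : ¬ T.Adj u x := by
    intro h
    have h2 : IsChild hT u u x := by
      refine ⟨h, ?_⟩
      rw [← treePath_eq hT (Walk.IsPath.nil (u := u))]
      simpa using hxu
    exact hsu (hx.parent_unique h2)
  obtain ⟨T1, hT1⟩ : ∃ T1, T1 = T.deleteEdges {s(u, v)} ⊔ edge v s := ⟨_, rfl⟩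
  obtain ⟨T2, hT2⟩ : ∃ T2, T2 = T1.deleteEdges {s(s, x)} ⊔ edge u x := ⟨_, rfl⟩
  have hadj1 : ∀ a b, T1.Adj a b ↔
      (T.Adj a b ∧ ¬ ((a = u ∧ b = v) ∨ (a = v ∧ b = u))) ∨
        ((a = v ∧ b = s) ∨ (a = s ∧ b = v)) := by
    intro a b
    simp only [hT1, sup_adj, deleteEdges_adj, edge_adj, Set.mem_singleton_iff, Sym2.eq_iff]
    have : v ≠ s := hsv.symm
    constructor
    · tauto
    · rintro (h | ⟨rfl, rfl⟩ | ⟨rfl, rfl⟩) <;> tauto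
  have hadj2 : ∀ a b, T2.Adj a b ↔
      (T1.Adj a b ∧ ¬ ((a = s ∧ b = x) ∨ (a = x ∧ b = s))) ∨
        ((a = u ∧ b = x) ∨ (a = x ∧ b = u)) := by
    intro a b
    simp only [hT2, sup_adj, deleteEdges_adj, edge_adj, Set.mem_singleton_iff, Sym2.eq_iff]
    have : u ≠ x := hxu.symm
    constructor
    · tauto
    · rintro (h | ⟨rfl, rfl⟩ | ⟨rfl, rfl⟩) <;> tauto
  have ht1 : T1.IsTree := by
    rw [hT1]
    refine isTree_exchange hT huv ?_
    rw [← hT1]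
    have h1 : T1.Reachable u s := by
      refine reachable_of_walk_of_notMem (Z := {v}) (fun a b hab hZ => ?_) (treePath hT u s)
        (fun z hz h => hs (h ▸ hz))
      rw [hadj1]
      simp only [Set.mem_singleton_iff] at hZ
      tauto
    refine h1.trans (Adj.reachable ?_)
    rw [hadj1]
    tauto
  have ht2 : T2.IsTree := by
    rw [hT2]
    refine isTree_exchange ht1 ((hadj1 _ _).2 (Or.inl ⟨hx.1, by tauto⟩)) ?_
    rw [← hT2]
    have h1 : T2.Reachable u s := by
      refine reachable_of_walk_of_notMem (Z := {v, x}) (fun a b hab hZ => ?_) (treePath hT u s)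
        (fun z hz h => ?_)
      · rw [hadj2, hadj1]
        simp only [Set.mem_singleton_iff, Set.mem_insert_iff] at hZ
        tauto
      · rcases h with rfl | h
        · exact hs hz
        · exact hxs (h ▸ hz)
    refine h1.symm.trans (Adj.reachable ?_)
    rw [hadj2]
    tauto
  refine ⟨T2, ?_, ht2, ?_⟩
  · intro a b hab
    rw [hadj2, hadj1] at hab
    rcases hab with ⟨⟨hab, h1⟩ | h1, h2⟩ | ⟨rfl, rfl⟩ | ⟨rfl, rfl⟩
    · rcases hG hab with h | h
      · exact h
      · rw [edge_adj] at h
        tauto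
    · rcases h1 with ⟨rfl, rfl⟩ | ⟨rfl, rfl⟩
      exacts [hvs, hvs.symm]
    · exact hux
    · exact hux.symm
  · refine le_trans (le_of_eq ?_) hk
    unfold leafCount
    congr 1
    apply Finset.filter_congr
    intro a _
    rw [degree_eq_of_double_exchange huv hx.1 hnvs hnux hsu.symm hxv.symm hsv.symm hxu.symm]
    intro a b
    rw [hadj2, hadj1]
    simp only [ne_eq, Sym2.eq_iff]
    have h1 : ¬ (v = s ∧ s = x) := fun h => hsv h.1.symm
    grind

open scoped Classical in
/-- If no exchange on the side of `u` produces a tree in `G`, the neighbours of `v` on that side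
have children, pairwise distinct, that are not neighbours of `u`. -/
theorem card_neighbors_side_lt {G T : SimpleGraph V} (hT : T.IsTree) {u v : V} {k : ℕ}
    (hG : T ≤ G ⊔ edge u v) (hk : leafCount T ≤ k) (huv : T.Adj u v) (hnuv : ¬ G.Adj u v)
    (hno : ¬ HasSpanningEndedTree k G) :
    (Finset.univ.filter fun x => v ∉ (treePath hT u x).support ∧ G.Adj u x).card +
      (Finset.univ.filter fun x => v ∉ (treePath hT u x).support ∧ G.Adj v x).card + 1 ≤
      (Finset.univ.filter fun x => v ∉ (treePath hT u x).support).card := by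
  have hch : ∀ s, v ∉ (treePath hT u s).support ∧ G.Adj v s → ∃ x, IsChild hT u s x := by
    rintro s ⟨h1, h2⟩
    have hsu : s ≠ u := by
      rintro rfl
      exact hnuv h2.symm
    refine exists_isChild hT hsu fun hd => hno ?_
    exact leaf_exchange hT hG hk huv hsu h1 h2 hd
  choose! f hf using hch
  set A := Finset.univ.filter fun x => v ∉ (treePath hT u x).support with hA
  set Nu := Finset.univ.filter fun x => v ∉ (treePath hT u x).support ∧ G.Adj u x with hNu
  set Nv := Finset.univ.filter fun x => v ∉ (treePath hT u x).support ∧ G.Adj v x with hNv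
  have hinj : Set.InjOn f Nv := by
    intro a ha b hb hab
    simp only [hNv, Finset.coe_filter, Finset.mem_univ, true_and, Set.mem_ofPred_eq] at ha hb
    have h1 := hf a ha
    have h2 := hf b hb
    rw [← hab] at h2
    exact h1.parent_unique h2
  have hdisj : Disjoint Nu (Nv.image f) := by
    rw [Finset.disjoint_left]
    intro x hx hx'
    obtain ⟨s, hs, rfl⟩ := Finset.mem_image.1 hx'
    simp only [hNv, hNu, Finset.mem_filter, Finset.mem_univ, true_and] at hs hx
    exact hno (double_exchange hT hG hk huv hnuv hs.1 hs.2 (hf s hs) hx.2)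
  have hu : treePath hT u u = Walk.nil := (treePath_eq hT (Walk.IsPath.nil (u := u))).symm
  have huu : u ∉ Nu ∪ Nv.image f := by
    intro h
    rcases Finset.mem_union.1 h with h | h
    · simp [hNu] at h
    · obtain ⟨s, hs, hfs⟩ := Finset.mem_image.1 h
      simp only [hNv, Finset.mem_filter, Finset.mem_univ, true_and] at hs
      have := (hf s hs).2
      rw [hfs] at this
      exact this (Walk.start_mem_support _)
  have hsub : insert u (Nu ∪ Nv.image f) ⊆ A := by
    intro x hx
    rcases Finset.mem_insert.1 hx with rfl | hx
    · simp [hA, hu, huv.ne']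
    rcases Finset.mem_union.1 hx with h | h
    · simp only [hNu, Finset.mem_filter, Finset.mem_univ, true_and] at h
      simp [hA, h.1]
    · obtain ⟨s, hs, rfl⟩ := Finset.mem_image.1 h
      simp only [hNv, Finset.mem_filter, Finset.mem_univ, true_and] at hs
      have h1 := hf s hs
      simp only [hA, Finset.mem_filter, Finset.mem_univ, true_and]
      rw [h1.treePath_eq, Walk.support_concat]
      simp only [List.mem_append, List.mem_singleton, not_or]
      refine ⟨hs.1, fun h => ?_⟩
      rw [← h] at h1
      have h2 : IsChild hT u u v := by
        refine ⟨huv, ?_⟩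
        rw [hu]
        simpa using huv.ne'
      have := h1.parent_unique h2
      subst this
      exact hnuv hs.2.symm
  have h1 := Finset.card_le_card hsub
  rw [Finset.card_insert_of_notMem huu, Finset.card_union_of_disjoint hdisj,
    Finset.card_image_of_injOn hinj] at h1
  exact h1

open scoped Classical in
/-- **Broersma–Tuinstra closure lemma.** Joining two non-adjacent vertices of degree sum at least
`|V| - 1` does not create a spanning tree with at most `k` leaves. -/
theorem hasSpanningEndedTree_of_sup_edge {G : SimpleGraph V} {u v : V} {k : ℕ}
    (hnuv : ¬ G.Adj u v) (hd : Fintype.card V - 1 ≤ G.degree u + G.degree v)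
    (h : HasSpanningEndedTree k (G ⊔ edge u v)) : HasSpanningEndedTree k G := by
  by_contra hno
  obtain ⟨T, hTG, hT, hk⟩ := hasSpanningEndedTree_iff.1 h
  have huv : T.Adj u v := by
    by_contra huv
    refine hno (hasSpanningEndedTree_iff.2 ⟨T, fun a b hab => ?_, hT, hk⟩)
    rcases hTG hab with h | h
    · exact h
    · rw [edge_adj] at h
      rcases h.1 with ⟨rfl, rfl⟩ | ⟨rfl, rfl⟩
      exacts [absurd hab huv, absurd hab.symm huv]
  have h1 := card_neighbors_side_lt hT hTG hk huv hnuv hno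
  have h2 := card_neighbors_side_lt hT (by rwa [edge_comm]) hk huv.symm (fun h => hnuv h.symm) hno
  have hm := fun x => mem_treePath_iff hT huv x
  have e0 := Finset.card_filter_add_card_filter_not (s := (Finset.univ : Finset V))
    (fun x => v ∉ (treePath hT u x).support)
  have e1 : ∀ w, (Finset.univ.filter fun x => v ∉ (treePath hT u x).support ∧ G.Adj w x).card +
      (Finset.univ.filter fun x => u ∉ (treePath hT v x).support ∧ G.Adj w x).card =
      G.degree w := by
    intro w
    rw [← card_neighborFinset_eq_degree, neighborFinset_eq_filter]
    rw [← Finset.card_filter_add_card_filter_not (s := Finset.univ.filter (G.Adj w))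
      (fun x => v ∉ (treePath hT u x).support), Finset.filter_filter, Finset.filter_filter]
    congr 2
    · ext x
      simp [and_comm]
    · ext x
      simp [and_comm, hm x]
  have e2 : (Finset.univ.filter fun x => ¬ v ∉ (treePath hT u x).support).card =
      (Finset.univ.filter fun x => u ∉ (treePath hT v x).support).card := by
    congr 1
    ext x
    simp [hm x]
  rw [e2, Finset.card_univ] at e0
  have e3 := e1 u
  have e4 := e1 v
  omega

/-- The `(n - 1)`-closure does not create spanning trees with at most `k` leaves. -/
theorem hasSpanningEndedTree_of_degClosure {G : SimpleGraph V} {k : ℕ}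
    (h : HasSpanningEndedTree k (degClosure (Fintype.card V - 1) G)) :
    HasSpanningEndedTree k G := by
  have h1 := (degClosure_spec (Fintype.card V - 1) G).1
  generalize degClosure (Fintype.card V - 1) G = H at h h1
  induction h1 with
  | refl => exact h
  | tail _ hs ih =>
    obtain ⟨u, v, -, hn, hl, rfl⟩ := hs
    exact ih (hasSpanningEndedTree_of_sup_edge hn hl h)

end Closure

/-! ### The exceptional graphs -/

section Exceptional

open scoped Classical in
/-- An acyclic graph on a nonempty vertex set has fewer edges than vertices. -/
theorem card_edgeFinset_lt_of_isAcyclic {W : Type*} [Fintype W] [Nonempty W] {F : SimpleGraph W}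
    (hF : F.IsAcyclic) : F.edgeFinset.card + 1 ≤ Fintype.card W := by
  obtain ⟨F', hFF', -, hF'⟩ :=
    (connected_top (V := W)).exists_isTree_le_of_le_of_isAcyclic le_top hF
  rw [← hF'.card_edgeFinset]
  exact Nat.succ_le_succ (Finset.card_le_card (edgeFinset_mono hFF'))

variable {V : Type*} [Fintype V]

open scoped Classical in
/-- Counting leaves: if every edge of a tree meets `X` or lies inside `B`, then the tree has at
least `|V \ B| - 2|X| + 2` leaves. -/
theorem card_add_two_le_leafCount {T : SimpleGraph V} (hT : T.IsTree) [Nontrivial V]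
    {X B : Finset V} (hB : B.Nonempty)
    (h : ∀ a b, T.Adj a b → a ∉ X → b ∉ X → a ∈ B) :
    Fintype.card V + 2 ≤ leafCount T + 2 * X.card + B.card := by
  have hne : Nonempty B := hB.to_subtype
  obtain ⟨F, hF⟩ : ∃ F, F = T.induce (B : Set V) := ⟨_, rfl⟩
  have h1 := card_edgeFinset_lt_of_isAcyclic (hF ▸ hT.isAcyclic.induce (B : Set V))
  have h2 : T.edgeFinset ⊆ X.biUnion (fun x => T.incidenceFinset x) ∪
      F.edgeFinset.image (Sym2.map Subtype.val) := by
    intro e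
    induction e with | h x y =>
    intro hxy
    rw [mem_edgeFinset, mem_edgeSet] at hxy
    rw [Finset.mem_union, Finset.mem_biUnion]
    by_cases hx : x ∈ X
    · exact Or.inl ⟨x, hx, by simp [hxy]⟩
    by_cases hy : y ∈ X
    · exact Or.inl ⟨y, hy, by rw [mem_incidenceFinset]; exact ⟨hxy, Sym2.mem_mk_right x y⟩⟩
    right
    have hxB := h x y hxy hx hy
    have hyB := h y x hxy.symm hy hx
    rw [Finset.mem_image]
    refine ⟨s(⟨x, hxB⟩, ⟨y, hyB⟩), ?_, rfl⟩
    rw [mem_edgeFinset, mem_edgeSet, hF]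
    exact hxy
  have h3 : T.edgeFinset.card ≤ ∑ x ∈ X, T.degree x +
      F.edgeFinset.card := by
    refine (Finset.card_le_card h2).trans ((Finset.card_union_le _ _).trans ?_)
    refine add_le_add (Finset.card_biUnion_le.trans (le_of_eq ?_)) Finset.card_image_le
    exact Finset.sum_congr rfl fun x _ => T.card_incidenceFinset_eq_degree x
  have h4 := hT.card_edgeFinset
  have h5 := T.sum_degrees_eq_twice_card_edges
  have h6 := Finset.sum_add_sum_compl X (fun x => T.degree x)
  have h7 : 2 * Xᶜ.card ≤ ∑ x ∈ Xᶜ, T.degree x + leafCount T := by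
    have e1 : ∑ x ∈ Xᶜ, (if T.degree x = 1 then 1 else 0) ≤ leafCount T := by
      unfold leafCount
      rw [Finset.card_filter]
      exact Finset.sum_le_sum_of_subset (Finset.subset_univ _)
    have e2 : ∑ x ∈ Xᶜ, 2 ≤ ∑ x ∈ Xᶜ, (T.degree x + if T.degree x = 1 then 1 else 0) := by
      refine Finset.sum_le_sum fun x _ => ?_
      have := hT.connected.preconnected.degree_pos_of_nontrivial x
      split_ifs <;> omega
    rw [Finset.sum_add_distrib] at e2
    simp only [Finset.sum_const, smul_eq_mul] at e2
    omega
  have h8 := Finset.card_add_card_compl X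
  have h9 : Fintype.card (B : Set V) = B.card := by simp
  omega

/-- A graph whose closure is `K_t ∇ (K_m ∪ (k + t - 1) K_1)` has no spanning tree with at most `k`
leaves. -/
theorem not_hasSpanningEndedTree_of_iso {G H : SimpleGraph V} (hGH : G ≤ H) {k t m : ℕ}
    (ht : 1 ≤ t) (hm : 1 ≤ m) (e : H ≃g joinGraph t m (k + t - 1)) :
    ¬ HasSpanningEndedTree k G := by
  classical
  intro h
  obtain ⟨T, hTG, hT, hL⟩ := hasSpanningEndedTree_iff.1 h
  have hcard : Fintype.card V = t + (m + (k + t - 1)) := by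
    rw [Fintype.card_congr e.toEquiv]
    simp
  have : Nontrivial V := Fintype.one_lt_card_iff_nontrivial.1 (by omega)
  have hinl : Function.Injective fun i : Fin t => e.symm (Sum.inl i) := fun i j hij => by
    simpa using hij
  have hinr : Function.Injective fun i : Fin m => e.symm (Sum.inr (Sum.inl i)) := fun i j hij => by
    simpa using hij
  have h1 := card_add_two_le_leafCount hT
    (X := Finset.univ.image fun i : Fin t => e.symm (Sum.inl i))
    (B := Finset.univ.image fun i : Fin m => e.symm (Sum.inr (Sum.inl i)))
    ⟨e.symm (Sum.inr (Sum.inl ⟨0, hm⟩)), by simp⟩ (by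
      intro a b hab ha hb
      have hadj := (e.map_adj_iff).2 (hGH (hTG hab))
      obtain ⟨a, rfl⟩ := e.symm.surjective a
      obtain ⟨b, rfl⟩ := e.symm.surjective b
      simp only [RelIso.apply_symm_apply] at hadj
      rcases a with a | a | a <;> rcases b with b | b | b <;>
        simp_all [joinGraph, join])
  rw [Finset.card_image_of_injective _ hinl, Finset.card_image_of_injective _ hinr,
    Finset.card_univ, Finset.card_univ, Fintype.card_fin, Fintype.card_fin] at h1
  omega

/-- Recognition of `K_t ∇ (K_b ∪ c K_1)`: all vertices outside a clique `C` have the same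
neighbourhood `X ⊆ C`. -/
theorem nonempty_iso_joinGraph {H : SimpleGraph V} {C X : Finset V} {b c : ℕ}
    (hC : ∀ u ∈ C, ∀ v ∈ C, u ≠ v → H.Adj u v) (hXC : X ⊆ C)
    (hN : ∀ v, v ∉ C → ∀ w, H.Adj v w ↔ w ∈ X) (hb : C.card = X.card + b)
    (hc : C.card + c = Fintype.card V) : Nonempty (H ≃g joinGraph X.card b c) := by
  classical
  have eX : Fin X.card ≃ X := X.equivFin.symm
  have eB : Fin b ≃ (C \ X : Finset V) := (Fintype.equivFinOfCardEq (by
    rw [Fintype.card_coe, Finset.card_sdiff_of_subset hXC]; omega)).symm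
  have eI : Fin c ≃ (Cᶜ : Finset V) := (Fintype.equivFinOfCardEq (by
    rw [Fintype.card_coe, Finset.card_compl]; omega)).symm
  let g : Fin X.card ⊕ (Fin b ⊕ Fin c) → V :=
    Sum.elim (fun i => (eX i : V)) (Sum.elim (fun i => (eB i : V)) fun i => (eI i : V))
  have hX : ∀ i, (eX i : V) ∈ X := fun i => (eX i).2
  have hB : ∀ i, (eB i : V) ∈ C ∧ (eB i : V) ∉ X := fun i => Finset.mem_sdiff.1 (eB i).2
  have hI : ∀ i, (eI i : V) ∉ C := fun i => Finset.mem_compl.1 (eI i).2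
  have hinj : Function.Injective g := by
    rintro (i | i | i) (j | j | j) hij <;> simp only [g, Sum.elim_inl, Sum.elim_inr] at hij
    · rw [eX.injective (Subtype.ext hij)]
    · exact absurd (hij ▸ hX i) (hB j).2
    · exact absurd (hXC (hij ▸ hX i)) (hI j)
    · exact absurd (hij ▸ hX j) (hB i).2
    · rw [eB.injective (Subtype.ext hij)]
    · exact absurd (hij ▸ (hB i).1) (hI j)
    · exact absurd (hXC (hij ▸ hX j)) (hI i)
    · exact absurd (hij ▸ (hB j).1) (hI i)
    · rw [eI.injective (Subtype.ext hij)]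
  have hbij : Function.Bijective g := by
    rw [Fintype.bijective_iff_injective_and_card]
    refine ⟨hinj, ?_⟩
    simp
    omega
  refine ⟨(⟨Equiv.ofBijective g hbij, ?_⟩ : joinGraph X.card b c ≃g H).symm⟩
  have hCa : ∀ p q, p ≠ q → g p ∈ C → g q ∈ C → H.Adj (g p) (g q) := fun p q hpq hp hq =>
    hC _ hp _ hq (hinj.ne hpq)
  have hIa : ∀ i w, H.Adj (eI i) w ↔ w ∈ X := fun i w => hN _ (hI i) w
  have hIa' : ∀ i w, H.Adj w (eI i) ↔ w ∈ X := fun i w => by rw [H.adj_comm, hIa]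
  have hIX : ∀ i, (eI i : V) ∉ X := fun i h => hI i (hXC h)
  rintro (i | i | i) (j | j | j) <;> simp only [Equiv.ofBijective_apply]
  · by_cases hij : i = j
    · subst hij
      simp
    · have := hCa (Sum.inl i) (Sum.inl j) (by simpa using hij) (hXC (hX i)) (hXC (hX j))
      simp [this, joinGraph, join, hij]
  · have := hCa (Sum.inl i) (Sum.inr (Sum.inl j)) (by simp) (hXC (hX i)) (hB j).1
    simp [this, joinGraph, join]
  · simp [g, hIa', hX, joinGraph, join]
  · have := hCa (Sum.inr (Sum.inl i)) (Sum.inl j) (by simp) (hB i).1 (hXC (hX j))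
    simp [this, joinGraph, join]
  · by_cases hij : i = j
    · subst hij
      simp
    · have := hCa (Sum.inr (Sum.inl i)) (Sum.inr (Sum.inl j)) (by simpa using hij) (hB i).1 (hB j).1
      simp [this, joinGraph, join, hij]
  · simp [g, hIa', (hB i).2, joinGraph, join]
  · simp [g, hIa, hX, joinGraph, join]
  · simp [g, hIa, (hB j).2, joinGraph, join]
  · simp [g, hIa, hIX, joinGraph, join]

end Exceptional

/-! ### Large cliques in closed graphs -/

section Clique

variable {V : Type*} [Fintype V]

theorem cast_mul_pred (a : ℕ) : ((a * (a - 1) : ℕ) : ℤ) = (a : ℤ) * (a - 1) := by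
  cases a <;> simp

/-- The two upper bounds for the number `E` of edges of a closed graph with a maximal clique of
size `c = n - s - y` contradict the lower bound. The first one is strong for small `y`, the second
one for large `y`. -/
theorem clique_size_arith {n s c y D E : ℕ} (hs : 1 ≤ s) (hn : 6 * s ≤ n + 1)
    (hy : n = c + s + y) (hD : 2 * D ≤ n - 2)
    (h0 : (c + y) * (c + y - 1) + 2 * (s * (s - 1)) + 2 ≤ 2 * E)
    (h1 : 2 * E ≤ c * (c - 1) + 2 * ((s + y) * (s + y - 1)))
    (h2 : 2 * E ≤ c * (n - 1) + (s + y) * D) : False := by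
  have hD' : 2 * (D : ℤ) ≤ n - 2 := by omega
  have hn2 : n = 6 * s - 1 → (D : ℤ) ≤ 3 * s - 2 := by omega
  zify [show 1 ≤ n by omega] at h0 h1 h2
  have t1 := cast_mul_pred c
  have t2 := cast_mul_pred (s + y)
  have t3 := cast_mul_pred (c + y)
  have t4 := cast_mul_pred s
  push_cast at t1 t2 t3 t4 h0 h1
  rw [t1, t2] at h1
  rw [t3, t4] at h0
  have hyZ : (n : ℤ) = c + s + y := by exact_mod_cast hy
  have hc0 : (0 : ℤ) ≤ c := by positivity
  have hy0 : (0 : ℤ) ≤ y := by positivity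
  have hs1 : (1 : ℤ) ≤ s := by exact_mod_cast hs
  have hkey : 2 * (c : ℤ) + 2 ≤ 4 * s + y := by
    by_contra hcon
    have h3 : (0 : ℤ) ≤ y * (2 * c - 4 * s - y + 1) := mul_nonneg hy0 (by omega)
    linarith
  rcases Nat.lt_or_ge n (6 * s) with hlt | hge
  · have h3 := hn2 (by omega)
    have hnZ : (n : ℤ) = 6 * s - 1 := by omega
    have hc : (c : ℤ) ≤ 3 * s - 1 := by omega
    have h4 : (s + y : ℤ) * D ≤ (s + y) * (3 * s - 2) :=
      mul_le_mul_of_nonneg_left h3 (by omega)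
    have h5 : (y : ℤ) = 5 * s - 1 - c := by omega
    have h6 : (0 : ℤ) ≤ s * (3 * s - 1 - c) := mul_nonneg (by omega) (by omega)
    rw [hnZ] at h2
    subst_vars
    rw [h5] at h0 h2 h4
    nlinarith
  · have hc : 3 * (c : ℤ) + 2 ≤ n + 3 * s := by omega
    have h4 : (s + y : ℤ) * (2 * D) ≤ (s + y) * (n - 2) :=
      mul_le_mul_of_nonneg_left hD' (by omega)
    have h6 : (0 : ℤ) ≤ n * (n + 3 * s - 2 - 3 * c) := mul_nonneg (by omega) (by omega)
    obtain ⟨m, hm⟩ : ∃ m : ℕ, n = 6 * s + m := ⟨n - 6 * s, by omega⟩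
    have h7 : (n : ℤ) = 6 * s + m := by exact_mod_cast hm
    have h5 : (y : ℤ) = 5 * s + m - c := by omega
    have h8 : (0 : ℤ) ≤ s * m := by positivity
    rw [h7] at h2 h4 h6
    rw [h5] at h0 h2 h4
    nlinarith

open scoped Classical in
/-- The edges leaving `C` are counted by the degrees outside `C`. -/
theorem sum_degree_le_card_mul_add (H : SimpleGraph V) (C : Finset V) :
    ∑ w ∈ C, H.degree w ≤ C.card * (C.card - 1) + ∑ v ∈ Cᶜ, H.degree v := by
  have h1 : ∀ w ∈ C, H.degree w ≤ (C.card - 1) + (Cᶜ.filter fun v => H.Adj w v).card := by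
    intro w hw
    rw [← card_neighborFinset_eq_degree, ← Finset.card_erase_of_mem hw]
    refine (Finset.card_le_card ?_).trans (Finset.card_union_le _ _)
    intro v hv
    rw [mem_neighborFinset] at hv
    have := hv.ne'
    by_cases hvC : v ∈ C <;> simp [hvC, this, hv]
  have h2 : ∑ w ∈ C, (Cᶜ.filter fun v => H.Adj w v).card =
      ∑ v ∈ Cᶜ, (C.filter fun w => H.Adj w v).card :=
    Finset.sum_card_bipartiteAbove_eq_sum_card_bipartiteBelow _
  have h3 : ∀ v ∈ Cᶜ, (C.filter fun w => H.Adj w v).card ≤ H.degree v := by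
    intro v _
    rw [← card_neighborFinset_eq_degree]
    refine Finset.card_le_card fun w hw => ?_
    rw [mem_neighborFinset]
    exact (Finset.mem_filter.1 hw).2.symm
  calc ∑ w ∈ C, H.degree w
      ≤ ∑ w ∈ C, ((C.card - 1) + (Cᶜ.filter fun v => H.Adj w v).card) := Finset.sum_le_sum h1
    _ = C.card * (C.card - 1) + ∑ w ∈ C, (Cᶜ.filter fun v => H.Adj w v).card := by
        rw [Finset.sum_add_distrib, Finset.sum_const, smul_eq_mul]
    _ ≤ _ := by
        rw [h2]
        exact Nat.add_le_add_left (Finset.sum_le_sum h3) _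

open scoped Classical in
/-- An `(n - 1)`-closed graph with many edges has a clique missing fewer than `s` vertices. -/
theorem exists_clique_of_isDegClosed {H : SimpleGraph V} {s : ℕ} (hs : 1 ≤ s)
    (hn : 6 * s - 1 ≤ Fintype.card V) (hH : IsDegClosed (Fintype.card V - 1) H)
    (he : (Fintype.card V - s).choose 2 + s * (s - 1) + 1 ≤ H.edgeFinset.card) :
    ∃ C : Finset V, (∀ u ∈ C, ∀ v ∈ C, u ≠ v → H.Adj u v) ∧
      Fintype.card V + 1 ≤ C.card + s := by
  set n := Fintype.card V with hnV
  have hH' : ∀ u v : V, u ≠ v → ¬ H.Adj u v → H.degree u + H.degree v + 2 ≤ n := by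
    intro u v huv h
    have h1 : H.degree u + H.degree v < n - 1 := by
      convert hH u v huv h
    omega
  obtain ⟨C, hCmem, hCmax⟩ := Finset.exists_max_image
    (Finset.univ.filter fun C : Finset V => (∀ u ∈ C, ∀ v ∈ C, u ≠ v → H.Adj u v) ∧
      ∀ v, n - 1 ≤ 2 * H.degree v → v ∈ C) Finset.card
    ⟨Finset.univ.filter fun v => n - 1 ≤ 2 * H.degree v, by
      simp only [Finset.mem_filter, Finset.mem_univ, true_and, imp_self, implies_true, and_true]
      intro u hu v hv huv
      by_contra h
      have := hH' u v huv h
      omega⟩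
  simp only [Finset.mem_filter, Finset.mem_univ, true_and] at hCmem hCmax
  obtain ⟨hC, hCdeg⟩ := hCmem
  refine ⟨C, hC, ?_⟩
  have hout : ∀ v ∈ Cᶜ, H.degree v ≤ n - 1 - C.card := by
    intro v hv
    rw [Finset.mem_compl] at hv
    obtain ⟨w, hw, hwv⟩ : ∃ w ∈ C, ¬ H.Adj v w := by
      by_contra! hall
      have h1 := hCmax (insert v C) ⟨?_, fun x hx => Finset.mem_insert_of_mem (hCdeg x hx)⟩
      · rw [Finset.card_insert_of_notMem hv] at h1
        omega
      · intro a ha b hb hab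
        rcases Finset.mem_insert.1 ha with rfl | ha
        · rcases Finset.mem_insert.1 hb with rfl | hb
          · exact absurd rfl hab
          · exact hall b ‹_›
        · rcases Finset.mem_insert.1 hb with hb' | hb
          · subst hb'
            exact (hall a ‹_›).symm
          · exact hC a ha b hb hab
    have h1 : C.card - 1 ≤ H.degree w := by
      rw [← card_neighborFinset_eq_degree, ← Finset.card_erase_of_mem hw]
      refine Finset.card_le_card fun x hx => ?_
      rw [mem_neighborFinset]
      exact hC w hw x (Finset.mem_of_mem_erase hx) (Finset.ne_of_mem_erase hx).symm
    have h2 := hH' v w (fun h => hv (h ▸ hw)) hwv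
    omega
  have hout2 : ∀ v ∈ Cᶜ, 2 * H.degree v ≤ n - 2 := by
    intro v hv
    rw [Finset.mem_compl] at hv
    by_contra h
    exact hv (hCdeg v (by omega))
  have hsum := H.sum_degrees_eq_twice_card_edges
  rw [← Finset.sum_add_sum_compl C] at hsum
  have hcle := Finset.card_le_univ C
  have hcc : Cᶜ.card = n - C.card := Finset.card_compl C
  have b1 := sum_degree_le_card_mul_add H C
  have b2 : ∑ v ∈ Cᶜ, H.degree v ≤ (n - C.card) * (n - 1 - C.card) := by
    rw [← hcc]
    simpa using Finset.sum_le_card_nsmul _ _ _ hout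
  have b3 : ∑ w ∈ C, H.degree w ≤ C.card * (n - 1) := by
    refine (Finset.sum_le_card_nsmul _ _ (n - 1) fun w _ => ?_).trans (by simp)
    have := H.degree_lt_card_verts w
    omega
  have b4 : ∑ v ∈ Cᶜ, H.degree v ≤ (n - C.card) * ((n - 2) / 2) := by
    rw [← hcc]
    refine (Finset.sum_le_card_nsmul _ _ ((n - 2) / 2) fun w hw => ?_).trans (by simp)
    have := hout2 w hw
    omega
  have hch : 2 * (n - s).choose 2 = (n - s) * (n - s - 1) := by
    rw [Nat.choose_two_right]
    exact Nat.mul_div_cancel' (Nat.even_mul_pred_self _).two_dvd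
  by_contra hlt
  obtain ⟨y, hy⟩ : ∃ y, n = C.card + s + y := ⟨n - C.card - s, by omega⟩
  have e1 : n - C.card = s + y := by omega
  have e2 : n - 1 - C.card = s + y - 1 := by omega
  have e3 : n - s = C.card + y := by omega
  rw [e1] at b2 b4
  rw [e2] at b2
  rw [e3] at he hch
  refine clique_size_arith (D := (n - 2) / 2) hs (by omega) hy (by omega)
    (E := H.edgeFinset.card) ?_ ?_ ?_ <;> omega

end Clique

/-! ### Growing trees from paths -/

section PartialTree

variable {V : Type*} [Fintype V]

open scoped Classical in
/-- `T` is a tree in `G` on the vertex set `S`; the vertices outside `S` are isolated in `T`. As in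
`isTree_of_connected_of_card_le`, acyclicity is encoded by the number of edges. -/
structure IsPartialTree (G : SimpleGraph V) (S : Finset V) (T : SimpleGraph V) : Prop where
  le : T ≤ G
  mem : ∀ a b, T.Adj a b → a ∈ S
  reachable : ∀ a ∈ S, ∀ b ∈ S, T.Reachable a b
  card_le : T.edgeFinset.card + 1 ≤ S.card

theorem HasSpanningEndedTree.mono {G : SimpleGraph V} {k l : ℕ} (h : HasSpanningEndedTree k G)
    (hkl : k ≤ l) : HasSpanningEndedTree l G := by
  rw [hasSpanningEndedTree_iff] at h ⊢
  obtain ⟨T, h1, h2, h3⟩ := h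
  exact ⟨T, h1, h2, h3.trans hkl⟩

open scoped Classical in
theorem IsPartialTree.exists_insert {G T : SimpleGraph V} {S : Finset V}
    (h : IsPartialTree G S T) {x y : V} (hx : x ∈ S) (hy : y ∉ S) (hxy : G.Adj x y) :
    ∃ T', IsPartialTree G (insert y S) T' ∧ T'.degree y = 1 ∧
      leafCount T' ≤ leafCount T + 2 ∧ (T.degree x ≠ 0 → leafCount T' ≤ leafCount T + 1) ∧
      (T.degree x = 1 → leafCount T' ≤ leafCount T) := by
  obtain ⟨T', hT'⟩ : ∃ T', T' = T ⊔ edge x y := ⟨_, rfl⟩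
  have hadj : ∀ a b, T'.Adj a b ↔ T.Adj a b ∨ (a = x ∧ b = y) ∨ (a = y ∧ b = x) := by
    intro a b
    have := hxy.ne
    simp only [hT', sup_adj, edge_adj]
    grind
  have hTy : ∀ b, ¬ T.Adj y b := fun b hb => hy (h.mem _ _ hb)
  have hTy' : ∀ b, ¬ T.Adj b y := fun b hb => hy (h.mem _ _ hb.symm)
  have hdy : T'.degree y = 1 := by
    rw [degree_eq_one_iff_existsUnique_adj]
    refine ⟨x, (hadj _ _).2 (Or.inr (Or.inr ⟨rfl, rfl⟩)), fun b hb => ?_⟩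
    rcases (hadj _ _).1 hb with h1 | h1 | h1
    · exact absurd h1 (hTy b)
    · exact absurd h1.1 hxy.ne'
    · exact h1.2
  have hdx : T'.degree x = T.degree x + 1 := by
    rw [← card_neighborFinset_eq_degree, ← card_neighborFinset_eq_degree,
      ← Finset.card_insert_of_notMem (s := T.neighborFinset x) (a := y) (by simpa using hTy' x)]
    congr 1
    ext b
    have := hxy.ne
    simp only [mem_neighborFinset, hadj, Finset.mem_insert]
    grind
  have hdo : ∀ a, a ≠ x → a ≠ y → T'.degree a = T.degree a := by
    intro a h1 h2
    refine degree_eq_of_adj_iff fun b => ?_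
    simp [hadj, h1, h2]
  have hle : T ≤ T' := hT' ▸ le_sup_left
  have hxy' : T'.Reachable x y := ((hadj _ _).2 (Or.inr (Or.inl ⟨rfl, rfl⟩)) : T'.Adj x y).reachable
  have hpt : IsPartialTree G (insert y S) T' := by
    refine ⟨?_, ?_, ?_, ?_⟩
    · intro a b hab
      rcases (hadj _ _).1 hab with h1 | ⟨rfl, rfl⟩ | ⟨rfl, rfl⟩
      exacts [h.le h1, hxy, hxy.symm]
    · intro a b hab
      rcases (hadj _ _).1 hab with h1 | ⟨rfl, rfl⟩ | ⟨rfl, rfl⟩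
      exacts [Finset.mem_insert_of_mem (h.mem _ _ h1), Finset.mem_insert_of_mem hx,
        Finset.mem_insert_self _ _]
    · have key : ∀ a ∈ insert y S, T'.Reachable x a := by
        intro a ha
        rcases Finset.mem_insert.1 ha with rfl | ha
        · exact hxy'
        · exact (h.reachable x hx a ha).mono hle
      exact fun a ha b hb => (key a ha).symm.trans (key b hb)
    · have h1 : T'.edgeFinset ⊆ insert s(x, y) T.edgeFinset := by
        intro e
        induction e with | h a b =>
        simp only [mem_edgeFinset, mem_edgeSet, hadj, Finset.mem_insert, Sym2.eq_iff]
        tauto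
      have h2 := (Finset.card_le_card h1).trans (Finset.card_insert_le _ _)
      have h3 := h.card_le
      rw [Finset.card_insert_of_notMem hy]
      omega
  refine ⟨T', hpt, hdy, ?_, ?_, ?_⟩
  · have h1 : (Finset.univ.filter fun v => T'.degree v = 1) ⊆
        insert x (insert y (Finset.univ.filter fun v => T.degree v = 1)) := by
      intro a ha
      have := hdo a
      simp only [Finset.mem_filter, Finset.mem_univ, true_and, Finset.mem_insert] at ha ⊢
      grind
    have h2 := Finset.card_le_card h1
    have h3 := Finset.card_insert_le x (insert y (Finset.univ.filter fun v => T.degree v = 1))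
    have h4 := Finset.card_insert_le y (Finset.univ.filter fun v => T.degree v = 1)
    unfold leafCount
    omega
  · intro hd
    have h1 : (Finset.univ.filter fun v => T'.degree v = 1) ⊆
        insert y (Finset.univ.filter fun v => T.degree v = 1) := by
      intro a ha
      have := hdo a
      simp only [Finset.mem_filter, Finset.mem_univ, true_and, Finset.mem_insert] at ha ⊢
      grind
    have h2 := Finset.card_le_card h1
    have h4 := Finset.card_insert_le y (Finset.univ.filter fun v => T.degree v = 1)
    unfold leafCount
    omega
  · intro hd
    have h1 : (Finset.univ.filter fun v => T'.degree v = 1) ⊆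
        insert y ((Finset.univ.filter fun v => T.degree v = 1).erase x) := by
      intro a ha
      have := hdo a
      simp only [Finset.mem_filter, Finset.mem_univ, true_and, Finset.mem_insert,
        Finset.mem_erase] at ha ⊢
      grind
    have h2 := Finset.card_le_card h1
    have h4 := Finset.card_insert_le y ((Finset.univ.filter fun v => T.degree v = 1).erase x)
    have h6 := Finset.card_erase_add_one
      (show x ∈ Finset.univ.filter fun v => T.degree v = 1 by simpa using hd)
    unfold leafCount
    omega

open scoped Classical in
theorem IsPartialTree.degree_ne_zero {G T : SimpleGraph V} {S : Finset V}
    (h : IsPartialTree G S T) (hS : 2 ≤ S.card) {x : V} (hx : x ∈ S) : T.degree x ≠ 0 := by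
  obtain ⟨z, hz, hzx⟩ := Finset.exists_mem_ne hS x
  obtain ⟨p⟩ := h.reachable x hx z hz
  cases p with
  | nil => exact absurd rfl hzx
  | cons hab _ => exact ((degree_pos_iff_exists_adj _ _).2 ⟨_, hab⟩).ne'

/-- A partial tree extends to a spanning tree with at most one new leaf per new vertex. -/
theorem IsPartialTree.hasSpanningEndedTree {G : SimpleGraph V} (hG : G.Connected)
    {S : Finset V} {T : SimpleGraph V} (h : IsPartialTree G S T) (hS : 2 ≤ S.card) :
    HasSpanningEndedTree (leafCount T + (Fintype.card V - S.card)) G := by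
  classical
  induction hm : Fintype.card V - S.card generalizing S T with
  | zero =>
    have hu : S = Finset.univ := by
      rw [← Finset.card_eq_iff_eq_univ]
      have := Finset.card_le_univ S
      omega
    rw [hasSpanningEndedTree_iff]
    have hne := hG.nonempty
    refine ⟨T, h.le, isTree_of_connected_of_card_le ?_ ?_, le_rfl⟩
    · exact (connected_iff _).2 ⟨fun a b => h.reachable a (hu ▸ Finset.mem_univ a) b
        (hu ▸ Finset.mem_univ b), hne⟩
    · have h1 := h.card_le
      rw [hu, Finset.card_univ] at h1
      exact h1
  | succ m ih =>
    obtain ⟨y, hy⟩ : ∃ y, y ∉ S := by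
      by_contra! hall
      rw [Finset.eq_univ_iff_forall.2 hall, Finset.card_univ] at hm
      omega
    obtain ⟨s, hs⟩ : S.Nonempty := Finset.card_pos.1 (by omega)
    obtain ⟨p⟩ := hG.preconnected s y
    obtain ⟨e, -, he1, he2⟩ := p.exists_boundary_dart (S : Set V) hs hy
    obtain ⟨T', hT', -, -, hl, -⟩ := h.exists_insert he1 he2 e.adj
    have hl := hl (h.degree_ne_zero hS he1)
    have hc := Finset.card_insert_of_notMem (Finset.mem_coe.not.1 he2)
    refine (ih hT' (by omega) (by omega)).mono (by omega)

/-- If the vertex-by-vertex extension of a partial tree exceeds the bound `k` by at most one leaf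
and there is no spanning tree with at most `k` leaves, then the remaining vertices are independent:
otherwise two of them could be attached with a single new leaf. -/
theorem IsPartialTree.independent_compl {G : SimpleGraph V} (hG : G.Connected)
    {S : Finset V} {T : SimpleGraph V} (h : IsPartialTree G S T) (hS : 2 ≤ S.card) {k : ℕ}
    (hno : ¬ HasSpanningEndedTree k G)
    (hk : leafCount T + (Fintype.card V - S.card) ≤ k + 1) :
    ∀ a b, a ∉ S → b ∉ S → ¬ G.Adj a b := by
  classical
  have key : ∀ s ∈ S, ∀ x, x ∉ S → ∀ y, y ∉ S → G.Adj s x → ¬ G.Adj x y := by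
    intro s hs x hx y hy hsx hxy
    obtain ⟨T1, hT1, hd1, -, hl1, -⟩ := h.exists_insert hs hx hsx
    have hl1 := hl1 (h.degree_ne_zero hS hs)
    have hy' : y ∉ insert x S := by simp [hy, hxy.ne']
    obtain ⟨T2, hT2, -, -, -, hl2⟩ := hT1.exists_insert (Finset.mem_insert_self _ _) hy' hxy
    have hl2 := hl2 hd1
    have hc1 := Finset.card_insert_of_notMem hx
    have hc2 := Finset.card_insert_of_notMem hy'
    have hc3 := Finset.card_le_univ (insert y (insert x S))
    exact hno ((hT2.hasSpanningEndedTree hG (by omega)).mono (by omega))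
  intro a b ha hb hab
  obtain ⟨s, hs⟩ : S.Nonempty := Finset.card_pos.1 (by omega)
  obtain ⟨p⟩ := hG.preconnected s a
  obtain ⟨e, -, he1, he2⟩ := p.exists_boundary_dart
    {v | v ∈ S ∨ ∃ s ∈ S, G.Adj s v} (Or.inl hs) (by
      rintro (h | ⟨s, hs, h⟩)
      exacts [ha h, key s hs a ha b hb h hab])
  have h2 : e.snd ∉ S := fun h => he2 (Or.inl h)
  rcases he1 with h1 | ⟨s, hs, h1⟩
  · exact he2 (Or.inr ⟨_, h1, e.adj⟩)
  · by_cases h3 : e.fst ∈ S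
    · exact he2 (Or.inr ⟨_, h3, e.adj⟩)
    · exact key s hs _ h3 _ h2 h1 e.adj

/-- A path, given by the list of its vertices. -/
def IsPathList {V : Type*} (G : SimpleGraph V) (P : List V) : Prop := P.IsChain G.Adj ∧ P.Nodup

open scoped Classical in
theorem IsPathList.exists_isPartialTree {G : SimpleGraph V} {P : List V} (hP : IsPathList G P)
    (hne : P ≠ []) : ∃ T, IsPartialTree G P.toFinset T ∧ leafCount T ≤ 2 := by
  suffices h : ∀ (l : List V) (x : V), IsPathList G (x :: l) →
      ∃ T, IsPartialTree G (x :: l).toFinset T ∧ leafCount T ≤ 2 ∧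
        (l = [] → leafCount T = 0) ∧ (l ≠ [] → T.degree x = 1) by
    obtain ⟨x, l, rfl⟩ := List.exists_cons_of_ne_nil hne
    obtain ⟨T, h1, h2, -⟩ := h l x hP
    exact ⟨T, h1, h2⟩
  intro l
  induction l with
  | nil =>
    intro x _
    obtain ⟨F, hF⟩ : ∃ F : SimpleGraph V, F = ⊥ := ⟨_, rfl⟩
    have h0 : leafCount F = 0 := by
      unfold leafCount
      rw [Finset.card_eq_zero, Finset.filter_eq_empty_iff]
      intro v _ hv
      obtain ⟨w, hw, -⟩ := degree_eq_one_iff_existsUnique_adj.1 hv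
      rw [hF] at hw
      exact hw
    refine ⟨F, ⟨hF ▸ bot_le, fun a b h => ?_, ?_, ?_⟩, by omega, fun _ => h0, fun h => absurd rfl h⟩
    · rw [hF] at h
      exact h.elim
    · intro a ha b hb
      simp only [List.toFinset_cons, List.toFinset_nil, insert_empty_eq,
        Finset.mem_singleton] at ha hb
      subst ha
      subst hb
      rfl
    · have h1 : F.edgeFinset = ∅ := by
        rw [← Finset.coe_eq_empty, coe_edgeFinset, hF, edgeSet_bot]
      simp [h1]
  | cons x l ih =>
    intro y hy
    obtain ⟨hc, hn⟩ := hy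
    rw [List.isChain_cons_cons] at hc
    rw [List.nodup_cons] at hn
    obtain ⟨T, hT, hl, hl0, hd⟩ := ih x ⟨hc.2, hn.2⟩
    obtain ⟨T', hT', hd', hl2, -, hl1⟩ := hT.exists_insert (x := x) (y := y) (by simp)
      (by simpa using hn.1) hc.1.symm
    refine ⟨T', by simpa using hT', ?_, by simp, fun _ => hd'⟩
    by_cases h : l = []
    · have := hl0 h
      omega
    · exact (hl1 (hd h)).trans hl

end PartialTree

/-! ### Rotations of longest paths -/

section Rotation

variable {V : Type*}

/-- `P` is a longest one among the paths of `G` that contain all vertices of `C`. -/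
structure IsMaxPath (G : SimpleGraph V) (C : Finset V) (P : List V) : Prop where
  isPathList : IsPathList G P
  mem : ∀ c ∈ C, c ∈ P
  max : ∀ Q, IsPathList G Q → (∀ c ∈ C, c ∈ Q) → Q.length ≤ P.length

theorem IsPathList.reverse {G : SimpleGraph V} {P : List V} (hP : IsPathList G P) :
    IsPathList G P.reverse := by
  refine ⟨?_, List.nodup_reverse.2 hP.2⟩
  rw [List.isChain_reverse]
  simpa only [G.adj_comm] using hP.1

theorem IsMaxPath.reverse {G : SimpleGraph V} {C : Finset V} {P : List V}
    (hP : IsMaxPath G C P) : IsMaxPath G C P.reverse :=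
  ⟨hP.isPathList.reverse, fun c hc => List.mem_reverse.2 (hP.mem c hc), fun Q h1 h2 => by
    rw [List.length_reverse]
    exact hP.max Q h1 h2⟩

/-- Any two vertices of `N` are joined by a path of `G` with at least one internal vertex, all of
whose internal vertices avoid `P`. -/
def HasDetours (G : SimpleGraph V) (P : List V) (N : Finset V) : Prop :=
  ∀ x ∈ N, ∀ y ∈ N, ∃ M : List V, M ≠ [] ∧ IsPathList G M ∧ (∀ m ∈ M, m ∉ P) ∧
    (∀ m ∈ M.head?, G.Adj x m) ∧ (∀ m ∈ M.getLast?, G.Adj y m)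

theorem HasDetours.reverse {G : SimpleGraph V} {P : List V} {N : Finset V}
    (h : HasDetours G P N) : HasDetours G P.reverse N := by
  simpa only [HasDetours, List.mem_reverse] using h

/-- A longest path `a ++ c` cannot be prolonged by a detour between `a` and `c`. -/
theorem IsMaxPath.not_insert {G : SimpleGraph V} {C N : Finset V} {a c : List V}
    (hP : IsMaxPath G C (a ++ c)) (hN : HasDetours G (a ++ c) N) (hne : a ++ c ≠ [])
    (ha : ∀ x ∈ a.getLast?, x ∈ N) (hc : ∀ y ∈ c.head?, y ∈ N) : False := by
  obtain ⟨x, hx, y, hy, hax, hcy⟩ : ∃ x ∈ N, ∃ y ∈ N, (∀ x' ∈ a.getLast?, x' = x) ∧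
      ∀ y' ∈ c.head?, y' = y := by
    rcases ha' : a.getLast? with _ | x <;> rcases hc' : c.head? with _ | y
    · rw [List.getLast?_eq_none_iff] at ha'
      rw [List.head?_eq_none_iff] at hc'
      simp [ha', hc'] at hne
    · have := hc y hc'
      exact ⟨y, this, y, this, by simp, by simp⟩
    · have := ha x ha'
      exact ⟨x, this, x, this, by simp, by simp⟩
    · exact ⟨x, ha x ha', y, hc y hc', by simp, by simp⟩
  obtain ⟨M, hM, ⟨hMc, hMn⟩, hMP, hMx, hMy⟩ := hN x hx y hy
  obtain ⟨⟨hch, hnd⟩, hmem, hmax⟩ := hP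
  rw [List.isChain_append] at hch
  rw [List.nodup_append] at hnd
  have h1 := hmax (a ++ (M ++ c)) ⟨?_, ?_⟩ fun v hv => ?_
  · have := List.length_pos_iff.2 hM
    simp only [List.length_append] at h1
    omega
  · rw [List.isChain_append, List.isChain_append]
    refine ⟨hch.1, ⟨hMc, hch.2.1, fun m hm y' hy' => ?_⟩, fun x' hx' m hm => ?_⟩
    · rw [hcy y' hy']
      exact (hMy m hm).symm
    · rw [List.head?_append_of_ne_nil _ hM] at hm
      rw [hax x' hx']
      exact hMx m hm
  · rw [List.nodup_append, List.nodup_append]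
    refine ⟨hnd.1, ⟨hMn, hnd.2.1, ?_⟩, ?_⟩
    · rintro m hm v hv rfl
      exact hMP m hm (List.mem_append_right _ hv)
    · rintro v hv m hm rfl
      rcases List.mem_append.1 hm with hm | hm
      · exact hMP v hm (List.mem_append_left _ hv)
      · exact hnd.2.2 v hv v hm rfl
  · have := hmem v hv
    simp only [List.mem_append] at this ⊢
    tauto

/-- The rotation step: in a longest path `a ++ b ++ c`, a detour between the last vertices of `a`
and `b` excludes an edge between the first vertices of `b` and `c`. -/
theorem IsMaxPath.not_rotate {G : SimpleGraph V} {C N : Finset V} {a b c : List V}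
    (hP : IsMaxPath G C (a ++ (b ++ c))) (hN : HasDetours G (a ++ (b ++ c)) N) (hb : b ≠ [])
    (ha : ∀ x ∈ a.getLast?, x ∈ N) (hbN : ∀ y ∈ b.getLast?, y ∈ N)
    (hbc : ∀ x ∈ b.head?, ∀ y ∈ c.head?, G.Adj x y) : False := by
  have hbl := List.getLast?_eq_some_getLast hb
  obtain ⟨x, hx, hax⟩ : ∃ x ∈ N, ∀ x' ∈ a.getLast?, x' = x := by
    rcases ha' : a.getLast? with _ | x
    · exact ⟨_, hbN _ hbl, by simp⟩
    · exact ⟨x, ha x ha', by simp⟩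
  obtain ⟨M, hM, ⟨hMc, hMn⟩, hMP, hMx, hMy⟩ := hN x hx _ (hbN _ hbl)
  obtain ⟨⟨hch, hnd⟩, hmem, hmax⟩ := hP
  rw [List.isChain_append, List.isChain_append] at hch
  rw [List.nodup_append, List.nodup_append] at hnd
  have h1 := hmax (a ++ (M ++ (b.reverse ++ c))) ⟨?_, ?_⟩ fun v hv => ?_
  · have := List.length_pos_iff.2 hM
    simp only [List.length_append, List.length_reverse] at h1
    omega
  · rw [List.isChain_append, List.isChain_append, List.isChain_append]
    refine ⟨hch.1, ⟨hMc, ⟨?_, hch.2.1.2.1, ?_⟩, fun m hm y' hy' => ?_⟩, fun x' hx' m hm => ?_⟩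
    · rw [List.isChain_reverse]
      simpa only [G.adj_comm] using hch.2.1.1
    · rw [List.getLast?_reverse]
      exact hbc
    · rw [List.head?_append_of_ne_nil _ (by simpa using hb), List.head?_reverse, hbl] at hy'
      rw [← Option.mem_some.1 hy']
      exact (hMy m hm).symm
    · rw [List.head?_append_of_ne_nil _ hM] at hm
      rw [hax x' hx']
      exact hMx m hm
  · rw [List.nodup_append, List.nodup_append, List.nodup_append]
    refine ⟨hnd.1, ⟨hMn, ⟨List.nodup_reverse.2 hnd.2.1.1, hnd.2.1.2.1, ?_⟩, ?_⟩, ?_⟩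
    · intro v hv w hw
      exact hnd.2.1.2.2 v (List.mem_reverse.1 hv) w hw
    · rintro m hm v hv rfl
      refine hMP m hm (List.mem_append_right _ ?_)
      simpa using hv
    · rintro v hv m hm rfl
      rcases List.mem_append.1 hm with hm | hm
      · exact hMP v hm (List.mem_append_left _ hv)
      · exact hnd.2.2 v hv v (by simpa using hm) rfl
  · have := hmem v hv
    simp only [List.mem_append, List.mem_reverse] at this ⊢
    tauto

/-- The position `i` of the path `P` is the first one or follows a vertex of `N`. -/
def IsStart (P : List V) (N : Finset V) (i : ℕ) : Prop := ∀ x, P[i - 1]? = some x → i = 0 ∨ x ∈ N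

theorem IsStart.getLast?_take {P : List V} {N : Finset V} {i : ℕ} (hi : i < P.length)
    (h : IsStart P N i) : ∀ x ∈ (P.take i).getLast?, x ∈ N := by
  intro x hx
  rw [List.getLast?_take] at hx
  split_ifs at hx with h0
  · simp at hx
  · rw [List.getElem?_eq_getElem (by omega), Option.some_or] at hx
    rcases h x (by rw [List.getElem?_eq_getElem (by omega)]; exact hx) with h1 | h1
    exacts [absurd h1 h0, h1]

theorem IsMaxPath.start_notMem {G : SimpleGraph V} {C N : Finset V} {P : List V}
    (hP : IsMaxPath G C P) (hN : HasDetours G P N) {i : ℕ} (hi : i < P.length)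
    (h : IsStart P N i) : P[i] ∉ N := by
  intro hPi
  have e : P = P.take i ++ P.drop i := (List.take_append_drop i P).symm
  rw [e] at hP hN
  refine hP.not_insert hN ?_ (h.getLast?_take hi) ?_
  · rw [← e]
    exact List.ne_nil_of_length_pos (by omega)
  · intro y hy
    rw [List.head?_drop, List.getElem?_eq_getElem hi] at hy
    rwa [← Option.mem_some.1 hy]

theorem IsMaxPath.last_notMem {G : SimpleGraph V} {C N : Finset V} {P : List V}
    (hP : IsMaxPath G C P) (hN : HasDetours G P N) (h0 : 0 < P.length) :
    P[P.length - 1] ∉ N := by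
  intro h
  have e : P = P ++ [] := by simp
  rw [e] at hP hN
  refine hP.not_insert hN (by simpa using List.ne_nil_of_length_pos h0) ?_ (by simp)
  intro x hx
  rw [List.getLast?_eq_getElem?, List.getElem?_eq_getElem (by omega)] at hx
  rwa [← Option.mem_some.1 hx]

theorem IsMaxPath.start_not_adj {G : SimpleGraph V} {C N : Finset V} {P : List V}
    (hP : IsMaxPath G C P) (hN : HasDetours G P N) {i j : ℕ} (hij : i < j) (hj : j < P.length)
    (hi : IsStart P N i) (hj' : IsStart P N j) : ¬ G.Adj P[i] P[j] := by
  intro hadj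
  have e : P = P.take i ++ ((P.drop i).take (j - i) ++ P.drop j) := by
    conv_lhs => rw [← List.take_append_drop i P, ← List.take_append_drop (j - i) (P.drop i)]
    rw [List.drop_drop]
    congr 4
    omega
  have hhead : ((P.drop i).take (j - i)).head? = some P[i] := by
    rw [List.head?_take, if_neg (by omega), List.head?_drop, List.getElem?_eq_getElem]
  have hlast : ((P.drop i).take (j - i)).getLast? = some P[j - 1] := by
    rw [List.getLast?_take, if_neg (by omega), List.getElem?_drop,
      List.getElem?_eq_getElem (by omega), Option.some_or]
    congr 2
    omega
  have hP' := hP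
  have hN' := hN
  rw [e] at hP' hN'
  refine hP'.not_rotate hN' (fun h => ?_) (hi.getLast?_take (by omega)) ?_ ?_
  · rw [h] at hhead
    simp at hhead
  · intro y hy
    rw [hlast] at hy
    rcases hj' y (by rw [List.getElem?_eq_getElem (by omega)]; exact hy) with h1 | h1
    exacts [by omega, h1]
  · intro x hx y hy
    rw [hhead] at hx
    rw [List.head?_drop, List.getElem?_eq_getElem hj] at hy
    rw [← Option.mem_some.1 hx, ← Option.mem_some.1 hy]
    exact hadj

open scoped Classical in
/-- The Chvátal–Erdős argument: if `C` is a clique and `N` a set of vertices of the longest path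
`P` with detours, then the successors of `N` and the first vertex are independent, so that at most
one of them lies in `C`. If there are at least as many vertices in `N` as vertices of `P` outside
`C`, then all the latter are among these successors. -/
theorem IsMaxPath.chvatal_erdos {G : SimpleGraph V} {C N : Finset V} {P : List V}
    (hP : IsMaxPath G C P) (h0 : 0 < P.length) (hC : ∀ u ∈ C, ∀ v ∈ C, u ≠ v → G.Adj u v)
    (hNP : ∀ x ∈ N, x ∈ P) (hN : HasDetours G P N) :
    N.card ≤ (P.toFinset \ C).card ∧ ((P.toFinset \ C).card ≤ N.card →
      (∀ (i : ℕ) (hi : i < P.length), P[i] ∉ C → IsStart P N i ∧ P[i] ∉ N) ∧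
      ∀ v ∈ P, v ∉ C → ∀ w ∈ P, w ∉ C → ¬ G.Adj v w) := by
  have hnd := hP.isPathList.2
  let f : ℕ → V := fun i => P.getD i P[0]
  have hf : ∀ (i : ℕ) (hi : i < P.length), f i = P[i] := fun i hi => by simp [f, hi]
  have hinj : ∀ i < P.length, ∀ j < P.length, f i = f j → i = j := by
    intro i hi j hj hij
    rw [hf i hi, hf j hj] at hij
    exact hnd.getElem_inj_iff.1 hij
  let J := (Finset.range P.length).filter fun j => f j ∈ N
  have hJN : J.image f = N := by
    ext x
    simp only [J, Finset.mem_image, Finset.mem_filter, Finset.mem_range]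
    constructor
    · rintro ⟨j, ⟨-, h⟩, rfl⟩
      exact h
    · intro hx
      obtain ⟨j, hj, rfl⟩ := List.getElem_of_mem (hNP x hx)
      exact ⟨j, ⟨hj, by rwa [hf j hj]⟩, hf j hj⟩
  have hJcard : J.card = N.card := by
    rw [← hJN, Finset.card_image_of_injOn]
    intro i hi j hj
    simp only [J, Finset.coe_filter, Set.mem_ofPred_eq, Finset.mem_range] at hi hj
    exact hinj i hi.1 j hj.1
  let K := insert 0 (J.image Nat.succ)
  have hKcard : K.card = N.card + 1 := by
    rw [Finset.card_insert_of_notMem (by simp), Finset.card_image_of_injective _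
      Nat.succ_injective, hJcard]
  have hK : ∀ i ∈ K, i < P.length ∧ IsStart P N i := by
    intro i hi
    rcases Finset.mem_insert.1 hi with rfl | hi
    · exact ⟨h0, fun x _ => Or.inl rfl⟩
    · obtain ⟨j, hj, rfl⟩ := Finset.mem_image.1 hi
      simp only [J, Finset.mem_filter, Finset.mem_range] at hj
      have hlast := hP.last_notMem hN h0
      have hjl : j + 1 < P.length := by
        by_contra h
        have : j = P.length - 1 := by omega
        subst this
        rw [hf _ hj.1] at hj
        exact hlast hj.2
      refine ⟨hjl, fun x hx => Or.inr ?_⟩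
      simp only [Nat.succ_eq_add_one, Nat.add_sub_cancel] at hx
      rw [List.getElem?_eq_getElem hj.1] at hx
      rw [← Option.mem_some.1 hx, ← hf j hj.1]
      exact hj.2
  have hindep : ∀ i ∈ K, ∀ j ∈ K, ¬ G.Adj (f i) (f j) := by
    intro i hi j hj hadj
    obtain ⟨hi1, hi2⟩ := hK i hi
    obtain ⟨hj1, hj2⟩ := hK j hj
    rcases lt_trichotomy i j with h | rfl | h
    · rw [hf i hi1, hf j hj1] at hadj
      exact hP.start_not_adj hN h hj1 hi2 hj2 hadj
    · exact hadj.ne rfl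
    · rw [hf i hi1, hf j hj1] at hadj
      exact hP.start_not_adj hN h hi1 hj2 hi2 hadj.symm
  have hfK : (K.image f).card = N.card + 1 := by
    rw [Finset.card_image_of_injOn, hKcard]
    intro i hi j hj
    exact hinj i (hK i hi).1 j (hK j hj).1
  have hKC : (K.image f ∩ C).card ≤ 1 := by
    rw [Finset.card_le_one]
    intro a ha b hb
    by_contra hab
    rw [Finset.mem_inter] at ha hb
    obtain ⟨i, hi, rfl⟩ := Finset.mem_image.1 ha.1
    obtain ⟨j, hj, rfl⟩ := Finset.mem_image.1 hb.1
    exact hindep i hi j hj (hC _ ha.2 _ hb.2 hab)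
  have hsub : K.image f \ C ⊆ P.toFinset \ C := by
    refine Finset.sdiff_subset_sdiff (fun x hx => ?_) le_rfl
    obtain ⟨i, hi, rfl⟩ := Finset.mem_image.1 hx
    rw [hf i (hK i hi).1, List.mem_toFinset]
    exact List.getElem_mem _
  have hcard := Finset.card_le_card hsub
  have hsum := Finset.card_inter_add_card_sdiff (K.image f) C
  refine ⟨by omega, fun hle => ?_⟩
  have heq : K.image f \ C = P.toFinset \ C := Finset.eq_of_subset_of_card_le hsub (by omega)
  have hmem : ∀ v ∈ P, v ∉ C → ∃ i ∈ K, f i = v := by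
    intro v hv hvC
    have : v ∈ K.image f \ C := by
      rw [heq, Finset.mem_sdiff, List.mem_toFinset]
      exact ⟨hv, hvC⟩
    exact Finset.mem_image.1 (Finset.mem_sdiff.1 this).1
  refine ⟨fun i hi hiC => ?_, fun v hv hvC w hw hwC => ?_⟩
  · obtain ⟨j, hj, hjf⟩ := hmem _ (List.getElem_mem hi) hiC
    obtain ⟨hj1, hj2⟩ := hK j hj
    have : j = i := hinj j hj1 i hi (hjf.trans (hf i hi).symm)
    subst this
    exact ⟨hj2, hP.start_notMem hN hi hj2⟩
  · obtain ⟨i, hi, rfl⟩ := hmem v hv hvC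
    obtain ⟨j, hj, rfl⟩ := hmem w hw hwC
    exact hindep i hi j hj

end Rotation

/-! ### The structure around a large clique -/

section Structure

variable {V : Type*}

open scoped Classical in
/-- In a `t`-connected graph, the component of `G - P` containing `d` has at least `t` neighbours
on the longest path `P`, any two of which are joined by a detour through that component. -/
theorem IsMaxPath.exists_hasDetours [Fintype V] {G : SimpleGraph V} {C : Finset V} {P : List V}
    {t : ℕ} (hG : IsTConnected t G) (hP : IsMaxPath G C P) (h0 : 0 < P.length) {d : V}
    (hd : d ∉ P) : ∃ N : Finset V, t ≤ N.card ∧ (∀ x ∈ N, x ∈ P) ∧ HasDetours G P N := by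
  let F : SimpleGraph V :=
    { Adj := fun a b => G.Adj a b ∧ a ∉ P ∧ b ∉ P
      symm := ⟨fun a b h => ⟨h.1.symm, h.2.2, h.2.1⟩⟩
      loopless := ⟨fun a h => h.1.ne rfl⟩ }
  have hFP : ∀ z, F.Reachable d z → z ∉ P := by
    rintro z ⟨p⟩
    induction p with
    | nil => exact hd
    | cons h _ ih => exact ih h.2.2
  let N := Finset.univ.filter fun x => x ∈ P ∧ ∃ z, F.Reachable d z ∧ G.Adj x z
  have hN : HasDetours G P N := by
    intro x hx y hy
    simp only [N, Finset.mem_filter, Finset.mem_univ, true_and] at hx hy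
    obtain ⟨-, z, hz, hxz⟩ := hx
    obtain ⟨-, w, hw, hyw⟩ := hy
    obtain ⟨p, hp⟩ := (hz.symm.trans hw).exists_isPath
    refine ⟨p.support, Walk.support_ne_nil p, ⟨p.isChain_adj_support.imp fun a b h => h.1,
      hp.support_nodup⟩, fun m hm => ?_, fun m hm => ?_, fun m hm => ?_⟩
    · exact hFP m (hz.trans (p.takeUntil m hm).reachable)
    · rw [List.head?_eq_some_head (Walk.support_ne_nil p), Walk.head_support] at hm
      rwa [← Option.mem_some.1 hm]
    · rw [List.getLast?_eq_some_getLast (Walk.support_ne_nil p), Walk.getLast_support] at hm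
      rwa [← Option.mem_some.1 hm]
  refine ⟨N, ?_, fun x hx => (Finset.mem_filter.1 hx).2.1, hN⟩
  by_contra hlt
  have hdN : d ∉ N := fun h => hd (Finset.mem_filter.1 h).2.1
  have h0N : P[0] ∉ N := hP.start_notMem hN h0 fun x _ => Or.inl rfl
  obtain ⟨p⟩ := (hG.2.2 N (by omega)).preconnected ⟨d, hdN⟩ ⟨P[0], h0N⟩
  obtain ⟨e, -, he1, he2⟩ := p.exists_boundary_dart {v | F.Reachable d v} (Reachable.refl d)
    fun h => hFP _ h (List.getElem_mem h0)
  have hadj : G.Adj e.fst e.snd := e.adj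
  by_cases h : (e.snd : V) ∈ P
  · refine e.snd.2 (Finset.mem_filter.2 ⟨Finset.mem_univ _, h, _, he1, hadj.symm⟩)
  · exact he2 (Reachable.trans he1 (Adj.reachable ⟨hadj, hFP _ he1, h⟩))

theorem hasDetours_of_adj {G : SimpleGraph V} {P : List V} {N : Finset V} {d : V} (hd : d ∉ P)
    (h : ∀ x ∈ N, G.Adj x d) : HasDetours G P N :=
  fun x hx y hy => ⟨[d], by simp, ⟨by simp, by simp⟩, by simpa using hd,
    by simpa using h x hx, by simpa using h y hy⟩

/-- A set `W` of `t` positions of a list of length at least `2 t` has at least `t` neighbouring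
positions: both shifts of `W` lose at most one element, and if they coincide after losing one, then
comparing sums gives length `2 t - 1`. -/
theorem card_le_card_shift_union {W : Finset ℕ} {m t : ℕ} (hW : ∀ i ∈ W, i < m) (ht : W.card = t)
    (hm : 2 * t ≤ m) :
    t ≤ ((W.erase 0).image Nat.pred ∪ (W.erase (m - 1)).image Nat.succ).card := by
  set A := (W.erase 0).image Nat.pred with hA
  set B := (W.erase (m - 1)).image Nat.succ with hB
  have hinj : Set.InjOn Nat.pred (W.erase 0 : Finset ℕ) := by
    intro a ha b hb hab
    simp only [Finset.coe_erase, Set.mem_sdiff, Set.mem_singleton_iff] at ha hb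
    simp only [Nat.pred_eq_sub_one] at hab
    omega
  have hAc : A.card = (W.erase 0).card := Finset.card_image_of_injOn hinj
  have hBc : B.card = (W.erase (m - 1)).card :=
    Finset.card_image_of_injective _ Nat.succ_injective
  have hAU : A.card ≤ (A ∪ B).card := Finset.card_le_card Finset.subset_union_left
  have hBU : B.card ≤ (A ∪ B).card := Finset.card_le_card Finset.subset_union_right
  by_contra hlt
  -- Both shifts lose an element, so `W` contains both end positions and the shifts coincide.
  have h0 : 0 ∈ W := by
    by_contra h
    rw [Finset.erase_eq_of_notMem h] at hAc
    omega
  have h1 : m - 1 ∈ W := by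
    by_contra h
    rw [Finset.erase_eq_of_notMem h] at hBc
    omega
  have c0 := Finset.card_erase_add_one h0
  have c1 := Finset.card_erase_add_one h1
  have e1 : A = A ∪ B := Finset.eq_of_subset_of_card_le Finset.subset_union_left (by omega)
  have e2 : B = A ∪ B := Finset.eq_of_subset_of_card_le Finset.subset_union_right (by omega)
  have hAB : A = B := e1.trans e2.symm
  have s1 : ∑ i ∈ A, i = ∑ i ∈ W.erase 0, Nat.pred i := Finset.sum_image hinj
  have s2 : ∑ i ∈ B, i = ∑ i ∈ W.erase (m - 1), (i + 1) :=
    Finset.sum_image Nat.succ_injective.injOn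
  have s3 : ∑ i ∈ W.erase 0, Nat.pred i + (W.erase 0).card = ∑ i ∈ W.erase 0, i := by
    rw [Finset.card_eq_sum_ones, ← Finset.sum_add_distrib]
    refine Finset.sum_congr rfl fun i hi => ?_
    have := Finset.ne_of_mem_erase hi
    simp only [Nat.pred_eq_sub_one]
    omega
  have s4 := Finset.sum_erase_add W (fun i => i) h0
  have s5 := Finset.sum_erase_add W (fun i => i) h1
  rw [Finset.sum_add_distrib, ← Finset.card_eq_sum_ones] at s2
  rw [hAB] at s1
  have := hW _ h0
  omega

/-- The vertices of the path `P` that are adjacent on `P` to a vertex outside `C`. -/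
def pathBoundary (C : Finset V) (P : List V) : Set V :=
  {x | ∃ j, P[j]? = some x ∧
    ((∃ y ∉ C, P[j + 1]? = some y) ∨ ∃ i, j = i + 1 ∧ ∃ y ∉ C, P[i]? = some y)}

open scoped Classical in
/-- If a vertex `d` off the longest path `P` has all its neighbours on `P`, and at least as many as
there are vertices of `P` outside the clique `C`, then its neighbours are exactly the path
neighbours of those vertices. -/
theorem IsMaxPath.neighborSet_eq_pathBoundary [Fintype V] {G : SimpleGraph V} {C : Finset V}
    {P : List V} (hP : IsMaxPath G C P) (h0 : 0 < P.length)
    (hC : ∀ u ∈ C, ∀ v ∈ C, u ≠ v → G.Adj u v) {d : V} (hd : d ∉ P)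
    (hNP : ∀ x, G.Adj d x → x ∈ P) (hcard : (P.toFinset \ C).card ≤ G.degree d)
    (hCcard : (P.toFinset \ C).card ≤ C.card) :
    G.neighborSet d = pathBoundary C P ∧ (∀ x, G.Adj d x → x ∈ C) ∧
      G.degree d = (P.toFinset \ C).card := by
  have hNP' : ∀ x ∈ G.neighborFinset d, x ∈ P := fun x hx => hNP x ((mem_neighborFinset _ _ _).1 hx)
  have hdet : HasDetours G P (G.neighborFinset d) :=
    hasDetours_of_adj hd fun x hx => ((mem_neighborFinset _ _ _).1 hx).symm
  obtain ⟨a1, a2⟩ := hP.chvatal_erdos h0 hC hNP' hdet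
  obtain ⟨a3, a4⟩ := a2 hcard
  obtain ⟨-, b2⟩ := hP.reverse.chvatal_erdos (by simpa using h0) hC (by simpa using hNP')
    hdet.reverse
  rw [List.toFinset_reverse] at b2
  obtain ⟨b3, -⟩ := b2 hcard
  rw [card_neighborFinset_eq_degree] at a1
  have hdeg : G.degree d = (P.toFinset \ C).card := le_antisymm a1 hcard
  have hlen : P.length = C.card + (P.toFinset \ C).card := by
    rw [← List.toFinset_card_of_nodup hP.isPathList.2, ← Finset.card_sdiff_add_card_eq_card
      (fun c hc => List.mem_toFinset.2 (hP.mem c hc) : C ⊆ P.toFinset), add_comm]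
  have hpred : ∀ i (hi : i + 1 < P.length), P[i + 1] ∉ C → G.Adj d P[i] := by
    intro i hi hiC
    have h1 := (a3 (i + 1) hi hiC).1 P[i] (by simp)
    simpa using h1
  have hsucc : ∀ i (hi : i + 1 < P.length), P[i] ∉ C → G.Adj d P[i + 1] := by
    intro i hi hiC
    have h1 := (b3 (P.length - 1 - i) (by rw [List.length_reverse]; omega) (by
      rw [List.getElem_reverse]
      convert hiC using 3
      omega)).1 P[i + 1] (by
        rw [List.getElem?_reverse (by omega), List.getElem?_eq_getElem (by omega)]
        congr 2
        omega)
    rcases h1 with h1 | h1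
    · omega
    · exact (mem_neighborFinset _ _ _).1 h1
  have hsub : pathBoundary C P ⊆ G.neighborSet d := by
    rintro x ⟨j, hj, ⟨y, hy, hyj⟩ | ⟨i, rfl, y, hy, hyi⟩⟩
    · obtain ⟨h1, rfl⟩ := List.getElem?_eq_some_iff.1 hj
      obtain ⟨h2, rfl⟩ := List.getElem?_eq_some_iff.1 hyj
      exact hpred j h2 hy
    · obtain ⟨h1, rfl⟩ := List.getElem?_eq_some_iff.1 hj
      obtain ⟨h2, rfl⟩ := List.getElem?_eq_some_iff.1 hyi
      exact hsucc i h1 hy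
  let f : ℕ → V := fun i => P.getD i d
  have hf : ∀ (i : ℕ) (hi : i < P.length), f i = P[i] := fun i hi => by simp [f, hi]
  have hinj : ∀ i < P.length, ∀ j < P.length, f i = f j → i = j := by
    intro i hi j hj hij
    rw [hf i hi, hf j hj] at hij
    exact hP.isPathList.2.getElem_inj_iff.1 hij
  let W := (Finset.range P.length).filter fun i => f i ∉ C
  have hW : ∀ i ∈ W, i < P.length := fun i hi => by
    simpa using (Finset.mem_filter.1 hi).1
  have hWC : ∀ i ∈ W, f i ∉ C := fun i hi => (Finset.mem_filter.1 hi).2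
  have hWcard : W.card = (P.toFinset \ C).card := by
    rw [← Finset.card_image_of_injOn (f := f) fun i hi j hj => hinj i (hW i hi) j (hW j hj)]
    congr 1
    ext x
    simp only [W, Finset.mem_image, Finset.mem_filter, Finset.mem_range, Finset.mem_sdiff,
      List.mem_toFinset]
    constructor
    · rintro ⟨i, ⟨hi, hiC⟩, rfl⟩
      exact ⟨by rw [hf i hi]; exact List.getElem_mem hi, hiC⟩
    · rintro ⟨hx, hxC⟩
      obtain ⟨i, hi, rfl⟩ := List.getElem_of_mem hx
      exact ⟨i, ⟨hi, by rwa [hf i hi]⟩, hf i hi⟩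
  have hshift := card_le_card_shift_union hW hWcard (by omega)
  set U := (W.erase 0).image Nat.pred ∪ (W.erase (P.length - 1)).image Nat.succ with hU
  have hUb : ∀ j ∈ U, j < P.length ∧ f j ∈ pathBoundary C P := by
    intro j hj
    rcases Finset.mem_union.1 hj with hj | hj
    · obtain ⟨i, hi, rfl⟩ := Finset.mem_image.1 hj
      obtain ⟨hi0, hiW⟩ := Finset.mem_erase.1 hi
      obtain ⟨i, rfl⟩ := Nat.exists_eq_succ_of_ne_zero hi0
      have h1 := hW _ hiW
      have h2 := hWC _ hiW
      simp only [Nat.succ_eq_add_one, Nat.pred_eq_sub_one, Nat.add_sub_cancel] at h1 h2 ⊢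
      refine ⟨by omega, i, ?_, Or.inl ⟨f (i + 1), h2, ?_⟩⟩
      · rw [hf i (by omega), List.getElem?_eq_getElem]
      · rw [hf _ h1, List.getElem?_eq_getElem]
    · obtain ⟨i, hi, rfl⟩ := Finset.mem_image.1 hj
      obtain ⟨hi0, hiW⟩ := Finset.mem_erase.1 hi
      have h1 := hW _ hiW
      have h2 := hWC _ hiW
      simp only [Nat.succ_eq_add_one]
      refine ⟨by omega, i + 1, ?_, Or.inr ⟨i, rfl, f i, h2, ?_⟩⟩
      · rw [hf _ (by omega), List.getElem?_eq_getElem]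
      · rw [hf _ h1, List.getElem?_eq_getElem]
  have hUN : U.image f = G.neighborFinset d := by
    refine Finset.eq_of_subset_of_card_le (fun x hx => ?_) ?_
    · obtain ⟨j, hj, rfl⟩ := Finset.mem_image.1 hx
      exact (mem_neighborFinset _ _ _).2 (hsub (hUb j hj).2)
    · rw [card_neighborFinset_eq_degree, hdeg, Finset.card_image_of_injOn fun i hi j hj =>
        hinj i (hUb i hi).1 j (hUb j hj).1]
      exact hshift
  refine ⟨Set.Subset.antisymm (fun x hx => ?_) hsub, fun x hx => ?_, hdeg⟩
  · have : x ∈ U.image f := by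
      rw [hUN, mem_neighborFinset]
      exact hx
    obtain ⟨j, hj, rfl⟩ := Finset.mem_image.1 this
    exact (hUb j hj).2
  · by_contra hxC
    obtain ⟨i, hi, rfl⟩ := List.getElem_of_mem (hNP x hx)
    exact (a3 i hi hxC).2 ((mem_neighborFinset _ _ _).2 hx)

/-- A clique lies on some path, hence on a longest one. -/
theorem exists_isMaxPath [Fintype V] {G : SimpleGraph V} {C : Finset V}
    (hC : ∀ u ∈ C, ∀ v ∈ C, u ≠ v → G.Adj u v) : ∃ P, IsMaxPath G C P := by
  classical
  let L : Set ℕ := {m | ∃ P, IsPathList G P ∧ (∀ c ∈ C, c ∈ P) ∧ P.length = m}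
  have hb : BddAbove L := by
    refine ⟨Fintype.card V, ?_⟩
    rintro m ⟨P, hP, -, rfl⟩
    exact hP.2.length_le_card
  have hne : L.Nonempty := by
    refine ⟨C.toList.length, C.toList, ⟨?_, C.nodup_toList⟩, by simp, rfl⟩
    apply List.Pairwise.isChain
    refine C.nodup_toList.imp_of_mem fun {a b} ha hb hab => ?_
    exact hC a (by simpa using ha) b (by simpa using hb) hab
  obtain ⟨P, hP, hPC, hlen⟩ := Nat.sSup_mem hne hb
  refine ⟨P, hP, hPC, fun Q hQ hQC => ?_⟩
  rw [hlen]
  exact le_csSup hb ⟨Q, hQ, hQC, rfl⟩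

open scoped Classical in
/-- The structure relative to one longest path through the clique of a graph without spanning tree
with at most `k` leaves. -/
theorem IsMaxPath.structure_of_not [Fintype V] {G : SimpleGraph V} {C : Finset V} {P : List V}
    {k t : ℕ} (hk : 2 ≤ k) (hG : IsTConnected t G) (hP : IsMaxPath G C P)
    (hC : ∀ u ∈ C, ∀ v ∈ C, u ≠ v → G.Adj u v) (hCt : t ≤ C.card) (hC2 : 2 ≤ C.card)
    (hCn : Fintype.card V ≤ C.card + (k + t - 1)) (hno : ¬ HasSpanningEndedTree k G) :
    Fintype.card V = C.card + (k + t - 1) ∧ (∃ d, d ∉ P) ∧ ∀ d, d ∉ P →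
      G.neighborSet d = pathBoundary C P ∧ (∀ x, G.Adj d x → x ∈ C) ∧ G.degree d = t := by
  have hCP : C ⊆ P.toFinset := fun c hc => List.mem_toFinset.2 (hP.mem c hc)
  have hlen : P.toFinset.card = P.length := List.toFinset_card_of_nodup hP.isPathList.2
  have hle := Finset.card_le_card hCP
  have h0 : 0 < P.length := by omega
  have hsd := Finset.card_sdiff_add_card_eq_card hCP
  obtain ⟨T, hT, hTl⟩ := hP.isPathList.exists_isPartialTree (List.ne_nil_of_length_pos h0)
  have hfew : k < leafCount T + (Fintype.card V - P.toFinset.card) := by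
    by_contra h
    exact hno ((hT.hasSpanningEndedTree hG.1 (by omega)).mono (by omega))
  obtain ⟨d, hd⟩ : ∃ d, d ∉ P := by
    by_contra! h
    have : P.toFinset = Finset.univ := Finset.eq_univ_iff_forall.2 fun v => by simpa using h v
    rw [this, Finset.card_univ] at hfew
    omega
  obtain ⟨N, hNt, hNP, hN⟩ := hP.exists_hasDetours hG h0 hd
  have hq := (hP.chvatal_erdos h0 hC hNP hN).1
  have hPt : (P.toFinset \ C).card = t := by omega
  refine ⟨by omega, ⟨d, hd⟩, fun d hd => ?_⟩
  have hind := hT.independent_compl hG.1 (by omega) hno (by omega)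
  have hdP : ∀ x, G.Adj d x → x ∈ P := by
    intro x hx
    by_contra hxP
    exact hind d x (by simpa using hd) (by simpa using hxP) hx
  have hdeg : t ≤ G.degree d := by
    obtain ⟨N, hNt, hNP, hN⟩ := hP.exists_hasDetours hG h0 hd
    by_contra hlt
    -- Removing the neighbours of `d` would isolate `d` from the clique.
    have hdN : d ∉ G.neighborFinset d := by simp
    obtain ⟨c, hc, hcN⟩ : ∃ c ∈ C, c ∉ G.neighborFinset d :=
      Finset.exists_mem_notMem_of_card_lt_card (by rw [card_neighborFinset_eq_degree]; omega)
    obtain ⟨p⟩ := (hG.2.2 (G.neighborFinset d) (by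
      rw [card_neighborFinset_eq_degree]; omega)).preconnected ⟨d, hdN⟩ ⟨c, hcN⟩
    cases p with
    | nil => exact hd (hP.mem _ hc)
    | @cons _ v _ h _ => exact v.2 ((mem_neighborFinset _ _ _).2 h)
  have := hP.neighborSet_eq_pathBoundary h0 hC hd hdP (by omega) (by omega)
  rwa [hPt] at this

open scoped Classical in
/-- Replacing a vertex outside the clique on a longest path by another one with the right
neighbours gives a longest path. -/
theorem IsMaxPath.set {G : SimpleGraph V} {C : Finset V} {P : List V} (hP : IsMaxPath G C P)
    {i : ℕ} (hi : i < P.length) (hiC : P[i] ∉ C) {d : V} (hd : d ∉ P)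
    (hdN : pathBoundary C P ⊆ G.neighborSet d) : IsMaxPath G C (P.set i d) := by
  have hch := List.isChain_iff_getElem.1 hP.isPathList.1
  refine ⟨⟨?_, hP.isPathList.2.set hd⟩, fun c hc => ?_, fun Q h1 h2 => ?_⟩
  · rw [List.isChain_iff_getElem]
    intro j hj
    rw [List.length_set] at hj
    rw [List.getElem_set, List.getElem_set]
    split_ifs with h1 h2 h2
    · omega
    · subst h1
      exact hdN ⟨i + 1, List.getElem?_eq_getElem hj, Or.inr ⟨i, rfl, _, hiC,
        List.getElem?_eq_getElem hi⟩⟩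
    · subst h2
      exact (hdN ⟨j, List.getElem?_eq_getElem (by omega), Or.inl ⟨_, hiC,
        List.getElem?_eq_getElem hi⟩⟩).symm
    · exact hch j hj
  · obtain ⟨j, hj, rfl⟩ := List.getElem_of_mem (hP.mem c hc)
    have hij : i ≠ j := by
      rintro rfl
      exact hiC hc
    rw [List.mem_iff_getElem]
    exact ⟨j, by simpa using hj, by rw [List.getElem_set_of_ne hij]⟩
  · rw [List.length_set]
    exact hP.max Q h1 h2

theorem pathBoundary_subset_set {C : Finset V} {P : List V} {i : ℕ} (hi : i < P.length)
    (hiC : P[i] ∉ C) {d : V} (hd : d ∉ C) (hb : ∀ x ∈ pathBoundary C P, x ∈ C) :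
    pathBoundary C P ⊆ pathBoundary C (P.set i d) := by
  have key : ∀ (j : ℕ) (y : V), y ∉ C → P[j]? = some y → ∃ y' ∉ C, (P.set i d)[j]? = some y' := by
    intro j y hy hj
    by_cases h : i = j
    · subst h
      exact ⟨d, hd, by simp [hi]⟩
    · exact ⟨y, hy, by rwa [List.getElem?_set_ne h]⟩
  intro x hx
  have hxC := hb x hx
  obtain ⟨j, hj, h⟩ := hx
  have hij : i ≠ j := by
    rintro rfl
    rw [List.getElem?_eq_getElem hi] at hj
    exact hiC (by rwa [Option.some.inj hj])
  refine ⟨j, by rwa [List.getElem?_set_ne hij], ?_⟩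
  rcases h with ⟨y, hy, h⟩ | ⟨l, hl, y, hy, h⟩
  · exact Or.inl (key _ y hy h)
  · exact Or.inr ⟨l, hl, key _ y hy h⟩

open scoped Classical in
/-- A `t`-connected graph with a clique `C` missing at most `k + t - 1` vertices has a spanning tree
with at most `k` leaves, unless exactly `k + t - 1` vertices are missing and all of them have the
same `t` neighbours, which lie in `C`. -/
theorem exists_common_neighborhood [Fintype V] {G : SimpleGraph V} {C : Finset V} {k t : ℕ}
    (hk : 2 ≤ k) (hG : IsTConnected t G) (hC : ∀ u ∈ C, ∀ v ∈ C, u ≠ v → G.Adj u v)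
    (hCt : t ≤ C.card) (hC2 : 2 ≤ C.card) (hCn : Fintype.card V ≤ C.card + (k + t - 1))
    (hno : ¬ HasSpanningEndedTree k G) :
    Fintype.card V = C.card + (k + t - 1) ∧ ∃ X ⊆ C, X.card = t ∧
      ∀ v, v ∉ C → ∀ w, G.Adj v w ↔ w ∈ X := by
  obtain ⟨P, hP⟩ := exists_isMaxPath hC
  obtain ⟨h1, ⟨d, hd⟩, h2⟩ := hP.structure_of_not hk hG hC hCt hC2 hCn hno
  obtain ⟨hdb, hdC, hdt⟩ := h2 d hd
  refine ⟨h1, G.neighborFinset d, fun x hx => hdC x ((mem_neighborFinset _ _ _).1 hx), hdt, ?_⟩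
  suffices h : ∀ v, v ∉ C → G.neighborSet v = G.neighborSet d by
    intro v hv w
    rw [mem_neighborFinset, ← mem_neighborSet, h v hv, mem_neighborSet]
  intro v hv
  by_cases hvP : v ∈ P
  · -- Exchange the roles of `v` and `d`.
    obtain ⟨i, hi, rfl⟩ := List.getElem_of_mem hvP
    have hP' := hP.set hi hv hd hdb.ge
    have hvP' : P[i] ∉ P.set i d := by
      intro h
      obtain ⟨j, hj, hji⟩ := List.getElem_of_mem h
      rw [List.getElem_set] at hji
      split_ifs at hji with hij
      · exact hd (hji ▸ List.getElem_mem hi)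
      · exact hij (hP.isPathList.2.getElem_inj_iff.1 hji).symm
    obtain ⟨hvb, -, hvt⟩ := (hP'.structure_of_not hk hG hC hCt hC2 hCn hno).2.2 _ hvP'
    have hsub := pathBoundary_subset_set hi hv (fun h => hd (hP.mem d h)) (fun x hx => by
      rw [← hdb] at hx
      exact hdC x hx)
    rw [← hdb, ← hvb] at hsub
    have hsub' : G.neighborFinset d ⊆ G.neighborFinset P[i] := by
      intro x hx
      rw [mem_neighborFinset] at hx ⊢
      exact hsub hx
    have heq := Finset.eq_of_subset_of_card_le hsub' (by
      rw [card_neighborFinset_eq_degree, card_neighborFinset_eq_degree]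
      omega)
    ext x
    rw [mem_neighborSet, mem_neighborSet, ← mem_neighborFinset, ← heq, mem_neighborFinset]
  · rw [(h2 v hvP).1, hdb]

end Structure

/-- Adding edges preserves `t`-connectedness. -/
theorem IsTConnected.mono {V : Type*} [Fintype V] {t : ℕ} {G H : SimpleGraph V}
    (h : IsTConnected t G) (hGH : G ≤ H) : IsTConnected t H :=
  ⟨h.1.mono hGH, h.2.1, fun S hS => (h.2.2 S hS).mono fun _ _ hab => hGH hab⟩

end SpanningEnded

open SpanningEnded in
theorem theorem1p6 {V : Type*} [Fintype V] [DecidableEq V] (G : SimpleGraph V)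
    [DecidableRel G.Adj] (k t n : ℕ) (hk : 2 ≤ k) (ht : 1 ≤ t)
    (hG : IsTConnected t G) (hcard : Fintype.card V = n)
    (hn : max (6 * k + 6 * t - 1) (k ^ 2 + t * k + t + 1) ≤ n)
    (he : (n - k - t).choose 2 + (k + t - 1) ^ 2 + k + t ≤ G.edgeFinset.card) :
    HasSpanningEndedTree k G ↔
      ¬ Nonempty (degClosure (n - 1) G ≃g joinGraph t (n - k - 2 * t + 1) (k + t - 1)) := by
  classical
  subst hcard
  have hn6 := (le_max_left _ _).trans hn
  have hspec := degClosure_spec (Fintype.card V - 1) G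
  have hle : G ≤ degClosure (Fintype.card V - 1) G := hspec.le
  constructor
  · rintro h ⟨e⟩
    exact not_hasSpanningEndedTree_of_iso hle ht (by omega) e h
  · intro hiso
    by_contra hno
    apply hiso
    have hno' : ¬ HasSpanningEndedTree k (degClosure (Fintype.card V - 1) G) :=
      fun h => hno (hasSpanningEndedTree_of_degClosure h)
    obtain ⟨H, hH⟩ : ∃ H, H = degClosure (Fintype.card V - 1) G := ⟨_, rfl⟩
    rw [← hH] at hspec hle hno' ⊢
    have hE : G.edgeFinset.card ≤ H.edgeFinset.card := Finset.card_le_card (SimpleGraph.edgeFinset_mono hle)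
    have hsq : (k + t) * (k + t - 1) + 1 ≤ (k + t - 1) ^ 2 + k + t := by
      obtain ⟨s, hs⟩ : ∃ s, k + t = s + 1 := ⟨k + t - 1, by omega⟩
      rw [add_assoc, hs, Nat.add_sub_cancel]
      nlinarith
    have hsub : Fintype.card V - k - t = Fintype.card V - (k + t) := by omega
    rw [hsub] at he
    obtain ⟨C, hC, hCn⟩ := exists_clique_of_isDegClosed (H := H) (s := k + t) (by omega) (by omega)
      hspec.2 (by omega)
    obtain ⟨h1, X, hXC, hXt, hX⟩ := exists_common_neighborhood hk (hG.mono hle) hC (by omega)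
      (by omega) (by omega) hno'
    subst hXt
    exact nonempty_iso_joinGraph hC hXC hX (by omega) (by omega)
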